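/- Let $K$ be a field of characteristic different from $2$. A Lie superalgebra over $K$ is a $\mathbb{Z}_2$-graded vector space $L=L_{\bar 0}\oplus L_{\bar 1}$ with an even bilinear bracket satisfying, for all homogeneous $x,y,z$ and all $x_0 \in L_{\bar 0}$, $$[x,y]=-(-1)^{|x||y|}[y,x],\quad [x,[y,z]]=[[x,y],z]+(-1)^{|x||y|}[y,[x,z]],\quad [x_0,x_0]=0 .$$ Put $L^1=L$, $L^{c+1}=[L^c,L]$; $L$ is nilpotent if $L^{c}=0$ for some $c$. The Schur multiplier of $L$ is $\mathcal M(L)=(R\cap[F,F])/[F,R]$, where $0\to R\to F\to L\to 0$ is a presentation of $L$ with $F$ a free Lie superalgebra (one may take $F$ free on the set of homogeneous elements of $L$). Theorem. Let $L$ be a nilpotent Lie superalgebra over $K$ with $\dim L_{\bar 0}=m$ and $\dim L_{\bar 1}=n$ finite, $n\geq 1$, $m+n>2$ and $\dim L^2=m+n-2$. Then $\mathcal M(L)$ is finite dimensional, and the number $t(L)$ defined by $$\dim\mathcal M(L)=\tfrac12\left[(n+m)^2+(n-m)\right]-t(L)$$ is a non-negative integer that satisfies $$(n+m)(n+m-3)+4\leq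 2t(L)<(n+m)^2+n-m .$$ -/

import Mathlib

/-- The sign `(-1)^{ij}` for parities `i j : ZMod 2`. -/
def parSign (K : Type*) [CommRing K] (i j : ZMod 2) : K := (-1) ^ (i.val * j.val)

/-- A Lie superalgebra structure on a `K`-module `L`: a decomposition into an even part `part 0`
and an odd part `part 1`, and an even bilinear bracket which satisfies graded skew-symmetry,
the graded Jacobi identity, and `[x, x] = 0` for even `x`. -/
class LieSuperalgebra (K L : Type*) [CommRing K] [AddCommGroup L] [Module K L] where
  part : ZMod 2 → Submodule K L
  isCompl_part : IsCompl (part 0) (part 1)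
  brk : L →ₗ[K] L →ₗ[K] L
  brk_mem : ∀ {i j : ZMod 2} {x y : L}, x ∈ part i → y ∈ part j → brk x y ∈ part (i + j)
  skew : ∀ {i j : ZMod 2} {x y : L}, x ∈ part i → y ∈ part j →
    brk x y = -(parSign K i j • brk y x)
  jacobi : ∀ {i j k : ZMod 2} {x y z : L}, x ∈ part i → y ∈ part j → z ∈ part k →
    brk x (brk y z) = brk (brk x y) z + parSign K i j • brk y (brk x z)
  even_self : ∀ {x : L}, x ∈ part 0 → brk x x = 0

/-! ### The free Lie superalgebra on a set with parities -/

namespace FreeLieSuper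

variable {X : Type*}

/-- The parity of a nonassociative word: the sum of the parities of its letters. -/
def wordParity (p : X → ZMod 2) : FreeMagma X → ZMod 2
  | FreeMagma.of x => p x
  | FreeMagma.mul u v => wordParity p u + wordParity p v

variable (K : Type*) [CommRing K]

/-- The product of the free nonassociative algebra `FreeMagma X →₀ K`: the bilinear extension of
the product of words. -/
noncomputable def wordMul : (FreeMagma X →₀ K) →ₗ[K] (FreeMagma X →₀ K) →ₗ[K] (FreeMagma X →₀ K) :=
  Finsupp.linearCombination K fun u => Finsupp.lmapDomain K K fun v => FreeMagma.mul u v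

/-- The combinations of words of parity `i`. -/
noncomputable def wordPart (p : X → ZMod 2) (i : ZMod 2) : Submodule K (FreeMagma X →₀ K) :=
  Finsupp.supported K K {w | wordParity p w = i}

/-- The defining relations of the free Lie superalgebra. -/
inductive Rel (p : X → ZMod 2) : (FreeMagma X →₀ K) → Prop
  | skew {i j : ZMod 2} {x y : FreeMagma X →₀ K} (hx : x ∈ wordPart K p i)
      (hy : y ∈ wordPart K p j) :
      Rel p (wordMul K x y + parSign K i j • wordMul K y x)
  | jacobi {i j k : ZMod 2} {x y z : FreeMagma X →₀ K} (hx : x ∈ wordPart K p i)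
      (hy : y ∈ wordPart K p j) (hz : z ∈ wordPart K p k) :
      Rel p (wordMul K x (wordMul K y z) -
        (wordMul K (wordMul K x y) z + parSign K i j • wordMul K y (wordMul K x z)))
  | even_self {x : FreeMagma X →₀ K} (hx : x ∈ wordPart K p 0) : Rel p (wordMul K x x)

/-- A submodule which is a two-sided ideal and contains the defining relations. -/
def IsRelIdeal (p : X → ZMod 2) (J : Submodule K (FreeMagma X →₀ K)) : Prop :=
  (∀ a, Rel K p a → a ∈ J) ∧
    ∀ x, ∀ a ∈ J, wordMul K x a ∈ J ∧ wordMul K a x ∈ J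

/-- The two-sided ideal generated by the defining relations. -/
noncomputable def relIdeal (p : X → ZMod 2) : Submodule K (FreeMagma X →₀ K) :=
  sInf {J | IsRelIdeal K p J}

variable {K}

lemma wordMul_single (u v : FreeMagma X) (a b : K) :
    wordMul K (Finsupp.single u a) (Finsupp.single v b) =
      Finsupp.single (FreeMagma.mul u v) (a * b) := by
  simp [wordMul, Finsupp.linearCombination_single, Finsupp.mapDomain_single]

lemma wordPart_eq_span (p : X → ZMod 2) (i : ZMod 2) :
    wordPart K p i =
      Submodule.span K ((fun w => Finsupp.single w (1 : K)) '' {w | wordParity p w = i}) :=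
  Finsupp.supported_eq_span_single K _

lemma wordMul_mem {p : X → ZMod 2} {i j : ZMod 2} {x y : FreeMagma X →₀ K}
    (hx : x ∈ wordPart K p i) (hy : y ∈ wordPart K p j) :
    wordMul K x y ∈ wordPart K p (i + j) := by
  have h : Submodule.map₂ (wordMul K) (wordPart K p i) (wordPart K p j) ≤
      wordPart K p (i + j) := by
    rw [wordPart_eq_span, wordPart_eq_span, Submodule.map₂_span_span, Submodule.span_le]
    rintro _ ⟨_, ⟨u, hu, rfl⟩, _, ⟨v, hv, rfl⟩, rfl⟩
    simp only [Set.mem_ofPred_eq] at hu hv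
    subst hu hv
    simp only [wordMul_single, mul_one, SetLike.mem_coe]
    exact Finsupp.single_mem_supported K _ rfl
  exact h (Submodule.apply_mem_map₂ _ hx hy)

lemma isCompl_wordPart (p : X → ZMod 2) : IsCompl (wordPart K p 0) (wordPart K p 1) := by
  constructor
  · apply Finsupp.disjoint_supported_supported
    rw [Set.disjoint_left]
    intro w h0 h1
    simp only [Set.mem_ofPred_eq] at h0 h1
    rw [h0] at h1
    exact absurd h1 (by decide)
  · rw [codisjoint_iff, wordPart, wordPart, ← Finsupp.supported_union]
    have : ({w | wordParity p w = 0} ∪ {w | wordParity p w = 1} : Set (FreeMagma X)) =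
        Set.univ := by
      ext w
      have : ∀ i : ZMod 2, i = 0 ∨ i = 1 := by decide
      simpa using this (wordParity p w)
    rw [this, Finsupp.supported_univ]

lemma isRelIdeal_relIdeal (p : X → ZMod 2) : IsRelIdeal K p (relIdeal K p) := by
  refine ⟨fun a ha => ?_, fun x a ha => ?_⟩
  · rw [relIdeal, Submodule.mem_sInf]
    exact fun J hJ => hJ.1 a ha
  · rw [relIdeal, Submodule.mem_sInf] at ha
    constructor <;> rw [relIdeal, Submodule.mem_sInf]
    · exact fun J hJ => (hJ.2 x a (ha J hJ)).1
    · exact fun J hJ => (hJ.2 x a (ha J hJ)).2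

/-- The elements of the ideal of relations that are sums of homogeneous elements of it. -/
noncomputable def homPart (p : X → ZMod 2) : Submodule K (FreeMagma X →₀ K) :=
  (relIdeal K p ⊓ wordPart K p 0) ⊔ (relIdeal K p ⊓ wordPart K p 1)

lemma mem_homPart {p : X → ZMod 2} {i : ZMod 2} {a : FreeMagma X →₀ K}
    (ha : a ∈ relIdeal K p) (hi : a ∈ wordPart K p i) : a ∈ homPart (K := K) p := by
  have : ∀ i : ZMod 2, i = 0 ∨ i = 1 := by decide
  rcases this i with rfl | rfl
  · exact Submodule.mem_sup_left ⟨ha, hi⟩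
  · exact Submodule.mem_sup_right ⟨ha, hi⟩

/-- The ideal of relations is homogeneous. -/
lemma relIdeal_le_homPart (p : X → ZMod 2) : relIdeal K p ≤ homPart (K := K) p := by
  have hI := isRelIdeal_relIdeal (K := K) p
  refine sInf_le ⟨?_, ?_⟩
  · intro a ha
    have ha' := hI.1 a ha
    cases ha with
    | @skew i j x y hx hy =>
      refine mem_homPart (i := i + j) ha' (add_mem (wordMul_mem hx hy) ?_)
      rw [add_comm i j]
      exact Submodule.smul_mem _ _ (wordMul_mem hy hx)
    | @jacobi i j k x y z hx hy hz =>
      refine mem_homPart (i := i + (j + k)) ha' (sub_mem (wordMul_mem hx (wordMul_mem hy hz))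
        (add_mem ?_ (Submodule.smul_mem _ _ ?_)))
      · rw [← add_assoc]
        exact wordMul_mem (wordMul_mem hx hy) hz
      · rw [add_left_comm]
        exact wordMul_mem hy (wordMul_mem hx hz)
    | even_self hx => exact mem_homPart ha' (wordMul_mem hx hx)
  · intro x a ha
    obtain ⟨x0, hx0, x1, hx1, rfl⟩ := Submodule.mem_sup.1
      ((isCompl_wordPart (K := K) p).sup_eq_top ▸ Submodule.mem_top : x ∈ _)
    obtain ⟨a0, ha0, a1, ha1, rfl⟩ := Submodule.mem_sup.1 ha
    simp only [map_add, LinearMap.add_apply]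
    refine ⟨add_mem (add_mem ?_ ?_) (add_mem ?_ ?_), add_mem (add_mem ?_ ?_) (add_mem ?_ ?_)⟩
    · exact mem_homPart (hI.2 _ _ ha0.1).1 (wordMul_mem hx0 ha0.2)
    · exact mem_homPart (hI.2 _ _ ha0.1).1 (wordMul_mem hx1 ha0.2)
    · exact mem_homPart (hI.2 _ _ ha1.1).1 (wordMul_mem hx0 ha1.2)
    · exact mem_homPart (hI.2 _ _ ha1.1).1 (wordMul_mem hx1 ha1.2)
    · exact mem_homPart (hI.2 _ _ ha0.1).2 (wordMul_mem ha0.2 hx0)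
    · exact mem_homPart (hI.2 _ _ ha1.1).2 (wordMul_mem ha1.2 hx0)
    · exact mem_homPart (hI.2 _ _ ha0.1).2 (wordMul_mem ha0.2 hx1)
    · exact mem_homPart (hI.2 _ _ ha1.1).2 (wordMul_mem ha1.2 hx1)

end FreeLieSuper

/-- The free Lie superalgebra over `K` on the set `X`, where `x : X` has parity `p x`. -/
abbrev FreeLieSuperalgebra (K : Type*) [CommRing K] {X : Type*} (p : X → ZMod 2) :=
  (FreeMagma X →₀ K) ⧸ FreeLieSuper.relIdeal K p

namespace FreeLieSuper

variable {K X : Type*} [CommRing K]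

/-- The bracket of the free Lie superalgebra, induced by the product of words. -/
noncomputable def freeBrk (p : X → ZMod 2) :
    FreeLieSuperalgebra K p →ₗ[K] FreeLieSuperalgebra K p →ₗ[K] FreeLieSuperalgebra K p :=
  (relIdeal K p).liftQ
    (LinearMap.flip ((relIdeal K p).liftQ
      (LinearMap.flip ((wordMul K).compr₂ (relIdeal K p).mkQ)) (by
        intro a ha
        rw [LinearMap.mem_ker]
        refine LinearMap.ext fun x => ?_
        simpa using ((isRelIdeal_relIdeal (K := K) p).2 _ a ha).1)))
    (by
      intro a ha
      rw [LinearMap.mem_ker]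
      refine LinearMap.ext fun y => ?_
      obtain ⟨y, rfl⟩ := (relIdeal K p).mkQ_surjective y
      simpa using ((isRelIdeal_relIdeal (K := K) p).2 _ a ha).2)

lemma freeBrk_mk (p : X → ZMod 2) (a b : FreeMagma X →₀ K) :
    freeBrk p ((relIdeal K p).mkQ a) ((relIdeal K p).mkQ b) =
      (relIdeal K p).mkQ (wordMul K a b) := rfl

noncomputable instance (p : X → ZMod 2) : LieSuperalgebra K (FreeLieSuperalgebra K p) where
  part i := (wordPart K p i).map (relIdeal K p).mkQ
  isCompl_part := by
    constructor
    · rw [Submodule.disjoint_def]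
      rintro _ ⟨a, ha, rfl⟩ ⟨b, hb, hab⟩
      have h : a - b ∈ relIdeal K p := by
        rw [← (relIdeal K p).ker_mkQ, LinearMap.mem_ker, map_sub, hab, sub_self]
      obtain ⟨c, hc, d, hd, hcd⟩ := Submodule.mem_sup.1 (relIdeal_le_homPart p h)
      have h0 : a - c = 0 := by
        refine (Submodule.disjoint_def.1 (isCompl_wordPart (K := K) p).disjoint) _
          (sub_mem ha hc.2) ?_
        have : a - c = b + d := by
          rw [sub_eq_iff_eq_add, add_assoc, add_comm d c, hcd]; abel
        rw [this]
        exact add_mem hb hd.2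
      rw [sub_eq_zero.1 h0]
      exact (Submodule.Quotient.mk_eq_zero _).2 hc.1
    · rw [codisjoint_iff, ← Submodule.map_sup, (isCompl_wordPart (K := K) p).sup_eq_top,
        Submodule.map_top, Submodule.range_mkQ]
  brk := freeBrk p
  brk_mem := by
    rintro i j _ _ ⟨a, ha, rfl⟩ ⟨b, hb, rfl⟩
    rw [freeBrk_mk]
    exact Submodule.mem_map_of_mem (wordMul_mem ha hb)
  skew := by
    rintro i j _ _ ⟨a, ha, rfl⟩ ⟨b, hb, rfl⟩
    rw [freeBrk_mk, freeBrk_mk, eq_neg_iff_add_eq_zero, ← map_smul, ← map_add]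
    exact (Submodule.Quotient.mk_eq_zero _).2
      ((isRelIdeal_relIdeal p).1 _ (Rel.skew ha hb))
  jacobi := by
    rintro i j k _ _ _ ⟨a, ha, rfl⟩ ⟨b, hb, rfl⟩ ⟨c, hc, rfl⟩
    rw [freeBrk_mk, freeBrk_mk, freeBrk_mk, freeBrk_mk, freeBrk_mk, freeBrk_mk, ← map_smul,
      ← map_add, ← sub_eq_zero, ← map_sub]
    exact (Submodule.Quotient.mk_eq_zero _).2
      ((isRelIdeal_relIdeal p).1 _ (Rel.jacobi ha hb hc))
  even_self := by
    rintro _ ⟨a, ha, rfl⟩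
    rw [freeBrk_mk]
    exact (Submodule.Quotient.mk_eq_zero _).2
      ((isRelIdeal_relIdeal p).1 _ (Rel.even_self ha))

/-- The generator of the free Lie superalgebra given by `x : X`. -/
noncomputable def of (K : Type*) [CommRing K] (p : X → ZMod 2) (x : X) :
    FreeLieSuperalgebra K p :=
  (relIdeal K p).mkQ (Finsupp.single (FreeMagma.of x) 1)

section lift

variable {L : Type*} [AddCommGroup L] [Module K L] [LieSuperalgebra K L]

open LieSuperalgebra

variable (K) in
/-- The value in `L` of a nonassociative word, given the values of the letters. -/
def evalWord (f : X → L) : FreeMagma X → L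
  | FreeMagma.of x => f x
  | FreeMagma.mul u v => brk (K := K) (evalWord f u) (evalWord f v)

lemma linearCombination_wordMul (f : X → L) (a b : FreeMagma X →₀ K) :
    Finsupp.linearCombination K (evalWord K f) (wordMul K a b) =
      brk (K := K) (Finsupp.linearCombination K (evalWord K f) a)
        (Finsupp.linearCombination K (evalWord K f) b) := by
  have h : (wordMul K).compr₂ (Finsupp.linearCombination K (evalWord K f)) =
      (brk (K := K) (L := L)).compl₁₂ (Finsupp.linearCombination K (evalWord K f))
        (Finsupp.linearCombination K (evalWord K f)) := by
    ext u v
    simp [wordMul_single, evalWord]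
  exact LinearMap.congr_fun₂ h a b

lemma linearCombination_mem {p : X → ZMod 2} {f : X → L} (hf : ∀ x, f x ∈ part (K := K) (p x))
    {i : ZMod 2} {a : FreeMagma X →₀ K} (ha : a ∈ wordPart K p i) :
    Finsupp.linearCombination K (evalWord K f) a ∈ part (K := K) i := by
  have hw : ∀ w, evalWord K f w ∈ part (K := K) (wordParity p w) := by
    intro w
    induction w with
    | ih1 x => exact hf x
    | ih2 u v hu hv => exact brk_mem hu hv
  rw [wordPart_eq_span] at ha
  induction ha using Submodule.span_induction with
  | mem x hx =>
    obtain ⟨w, rfl, rfl⟩ := hx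
    simpa using hw w
  | zero => simp
  | add x y _ _ hx hy => rw [map_add]; exact add_mem hx hy
  | smul c x _ hx => rw [map_smul]; exact Submodule.smul_mem _ _ hx

/-- The homomorphism from the free Lie superalgebra to `L` that extends a parity-preserving map
`f : X → L`. -/
noncomputable def lift {p : X → ZMod 2} (f : X → L) (hf : ∀ x, f x ∈ part (K := K) (p x)) :
    FreeLieSuperalgebra K p →ₗ[K] L :=
  (relIdeal K p).liftQ (Finsupp.linearCombination K (evalWord K f)) <| by
    refine sInf_le ⟨?_, ?_⟩
    · intro a ha
      rw [LinearMap.mem_ker]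
      cases ha with
      | skew hx hy =>
        simp only [map_add, map_smul, linearCombination_wordMul]
        rw [skew (linearCombination_mem hf hx) (linearCombination_mem hf hy), neg_add_cancel]
      | jacobi hx hy hz =>
        simp only [map_add, map_sub, map_smul, linearCombination_wordMul]
        rw [jacobi (linearCombination_mem hf hx) (linearCombination_mem hf hy)
          (linearCombination_mem hf hz), sub_self]
      | even_self hx =>
        rw [linearCombination_wordMul, even_self (linearCombination_mem hf hx)]
    · intro x a ha
      rw [LinearMap.mem_ker] at ha
      simp [linearCombination_wordMul, ha]

lemma lift_of {p : X → ZMod 2} (f : X → L) (hf : ∀ x, f x ∈ part (K := K) (p x)) (x : X) :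
    lift f hf (of K p x) = f x := by
  change Finsupp.linearCombination K (evalWord K f) (Finsupp.single (FreeMagma.of x) 1) = f x
  simp [evalWord]

lemma lift_brk {p : X → ZMod 2} (f : X → L) (hf : ∀ x, f x ∈ part (K := K) (p x))
    (a b : FreeLieSuperalgebra K p) :
    lift f hf (brk (K := K) a b) = brk (K := K) (lift f hf a) (lift f hf b) := by
  obtain ⟨a, rfl⟩ := (relIdeal K p).mkQ_surjective a
  obtain ⟨b, rfl⟩ := (relIdeal K p).mkQ_surjective b
  exact linearCombination_wordMul f a b

lemma lift_mem {p : X → ZMod 2} (f : X → L) (hf : ∀ x, f x ∈ part (K := K) (p x)) {i : ZMod 2}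
    {a : FreeLieSuperalgebra K p} (ha : a ∈ part (K := K) i) : lift f hf a ∈ part (K := K) i := by
  obtain ⟨a, ha, rfl⟩ := ha
  exact linearCombination_mem hf ha

end lift

end FreeLieSuper

/-! ### The descending central sequence and the Schur multiplier -/

namespace LieSuperalgebra

variable (K L : Type*) [CommRing K] [AddCommGroup L] [Module K L] [LieSuperalgebra K L]

/-- The descending central sequence `L¹ = L`, `L^{c+1} = [L^c, L]`, with the index shifted by one:
`lowerCentral K L c` is `L^{c+1}`. -/
def lowerCentral : ℕ → Submodule K L
  | 0 => ⊤
  | c + 1 => Submodule.map₂ brk (lowerCentral c) ⊤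

/-- `L` is nilpotent if its descending central sequence reaches zero. -/
def Nilpotent : Prop := ∃ c, lowerCentral K L c = ⊥

/-- The derived superalgebra `L² = [L, L]`, the span of all brackets. -/
def derived : Submodule K L := Submodule.map₂ brk ⊤ ⊤

variable {K L} in
/-- For a linear map `π : F → L` from a Lie superalgebra `F`, with kernel `R`, the space
`(R ∩ [F, F]) / [F, R]`. -/
abbrev HopfQuotient {F : Type*} [AddCommGroup F] [Module K F] [LieSuperalgebra K F]
    (π : F →ₗ[K] L) : Type _ :=
  ↥(LinearMap.ker π ⊓ derived K F) ⧸
    (Submodule.map₂ (brk (K := K)) (⊤ : Submodule K F) (LinearMap.ker π)).submoduleOf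
      (LinearMap.ker π ⊓ derived K F)

/-- The standard free presentation `π : F → L`, in which `F` is free on the set of all homogeneous
elements of `L` (with their parities) and `π` sends each generator to the element it stands for. -/
noncomputable def presentation :
    FreeLieSuperalgebra K (Sigma.fst : (Σ i : ZMod 2, part (K := K) (L := L) i) → ZMod 2) →ₗ[K] L :=
  FreeLieSuper.lift (fun x => (x.2 : L)) fun x => x.2.2

lemma presentation_surjective : Function.Surjective (presentation K L) := by
  rw [← LinearMap.range_eq_top, eq_top_iff, ← (isCompl_part (K := K) (L := L)).sup_eq_top]
  refine sup_le ?_ ?_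
  · exact fun x hx => ⟨FreeLieSuper.of K _ ⟨0, x, hx⟩, FreeLieSuper.lift_of _ _ _⟩
  · exact fun x hx => ⟨FreeLieSuper.of K _ ⟨1, x, hx⟩, FreeLieSuper.lift_of _ _ _⟩

/-- The Schur multiplier `M(L) = (R ∩ [F, F]) / [F, R]` of `L`, where `0 → R → F → L → 0` is the
standard free presentation of `L`. -/
abbrev SchurMultiplier : Type _ := HopfQuotient (presentation K L)

/-- The invariant `t(L)` of a Lie superalgebra of dimension `(m | n)`, defined by
`dim M(L) = ½ ((n + m)² + (n - m)) - t(L)`. -/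
noncomputable def t : ℚ :=
  let m : ℚ := Module.finrank K (part (K := K) (L := L) 0)
  let n : ℚ := Module.finrank K (part (K := K) (L := L) 1)
  1 / 2 * ((n + m) ^ 2 + (n - m)) - Module.finrank K (SchurMultiplier K L)

end LieSuperalgebra

/-!
Let `π : F → L` be a surjection of Lie superalgebras with kernel `R`, and write `F²` for `[F, F]`.
Since `dim L² = m + n - 2` and `L` is nilpotent with nonzero odd part, `L` is generated by an odd
element `b` and a homogeneous element `a` of some parity `p`. The theorem amounts to
`1 ≤ dim M(L) ≤ m + n - 1 + p`, because `1 + p ≤ n`.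

*Upper bound* (`relDimLE_inf_derived`). This does not use that `F` is free. Let `S` run through
homogeneous ideals between `R` and `R + F²`, starting with the largest one, for which
`(S ∩ F²) / [F, S]` is spanned by `[b, b]`, `[b, a]`, `[a, a]` (the last one being zero for even
`a`). If `S' = S + ⟨s⟩` with `s ∈ F²` homogeneous and `[F, s] ≤ S`, then `[F, S'] / [F, S]` is
spanned by `[a, s]` and `[b, s]`, whereas `S ∩ F²` has codimension one in `S' ∩ F²`, so that the
dimension grows by at most one. In the first step it does not grow at all: `F²` is then spanned by
`s` modulo `S`, and the Jacobi identity `2 [b, [b, a]] = [[b, b], a]` becomes a linear relation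
between `[a, s]` and `[b, s]` modulo `[F, S]` (`exists_brk_dependence`).

*Lower bound* (`not_ker_inf_derived_le`). Suppose `R ∩ F² = [F, R]` for the standard presentation.
As free Lie superalgebras are projective, the same holds for the presentation with `F` free on `a`
and `b`, where moreover `R ≤ F²`; thus `R = [F, R]`. Then every homomorphism from `F` to a
residually nilpotent Lie superalgebra kills `R`, so its image has finite dimension. But the
semidirect product `ShiftSuperalgebra` of `⟨y, y²⟩` and `K[X] ⊕ K[X]`, with `y` odd acting by
multiplication with `X` composed with the swap of the summands, is residually nilpotent, and `y`
together with a homogeneous element of `K[X] ⊕ K[X]` of either parity generates a subalgebra of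
infinite dimension.
-/

/-! ### Relative dimension of submodules -/

/-- `RelDimLE B A n` says that `A` is contained in the sum of `B` and the span of at most `n`
vectors, i.e. that `(A + B) / B` has dimension at most `n`. -/
def RelDimLE {K V : Type*} [Field K] [AddCommGroup V] [Module K V] (B A : Submodule K V)
    (n : ℕ) : Prop :=
  ∃ s : Finset V, s.card ≤ n ∧ A ≤ B ⊔ Submodule.span K (s : Set V)

namespace RelDimLE

variable {K V : Type*} [Field K] [AddCommGroup V] [Module K V] {A B C : Submodule K V} {m n : ℕ}

lemma of_le_span (s : Finset V) (h : A ≤ B ⊔ Submodule.span K (s : Set V)) (hs : s.card ≤ n) :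
    RelDimLE B A n := ⟨s, hs, h⟩

lemma mono (h : RelDimLE B A m) (hmn : m ≤ n) : RelDimLE B A n :=
  let ⟨s, hs, hA⟩ := h
  ⟨s, hs.trans hmn, hA⟩

lemma trans (hBC : RelDimLE C B m) (hAB : RelDimLE B A n) : RelDimLE C A (m + n) := by
  classical
  obtain ⟨s, hs, hB⟩ := hBC
  obtain ⟨t, ht, hA⟩ := hAB
  refine ⟨s ∪ t, (Finset.card_union_le s t).trans (add_le_add hs ht), hA.trans ?_⟩
  rw [Finset.coe_union, Submodule.span_union, ← sup_assoc]
  exact sup_le_sup_right hB _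

lemma iff_finrank : RelDimLE B A n ↔
    Module.Finite K (A.map B.mkQ) ∧ Module.finrank K (A.map B.mkQ) ≤ n := by
  classical
  constructor
  · rintro ⟨s, hs, hA⟩
    have hle : A.map B.mkQ ≤ Submodule.span K ((s.image B.mkQ : Finset (V ⧸ B)) : Set (V ⧸ B)) := by
      refine (Submodule.map_mono hA).trans ?_
      rw [Submodule.map_sup, Submodule.mkQ_map_self, bot_sup_eq, Submodule.map_span,
        Finset.coe_image]
    have hfin : Module.Finite K
        (Submodule.span K ((s.image B.mkQ : Finset (V ⧸ B)) : Set (V ⧸ B))) := inferInstance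
    refine ⟨Submodule.finiteDimensional_of_le hle, (Submodule.finrank_mono hle).trans ?_⟩
    exact (finrank_span_finset_le_card _).trans (Finset.card_image_le.trans hs)
  · rintro ⟨hfin, hn⟩
    let b := Module.finBasis K (A.map B.mkQ)
    have hb : ∀ i, ∃ v : V, B.mkQ v = b i := fun i => B.mkQ_surjective _
    choose v hv using hb
    refine ⟨Finset.univ.image v, Finset.card_image_le.trans (by simpa using hn), fun x hx => ?_⟩
    have hspan : A.map B.mkQ ≤ (Submodule.span K (Set.range v)).map B.mkQ := by
      rw [Submodule.map_span, ← Set.range_comp]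
      have h1 : B.mkQ ∘ v = (A.map B.mkQ).subtype ∘ b := funext hv
      rw [h1, Set.range_comp, ← Submodule.map_span, b.span_eq, Submodule.map_top,
        Submodule.range_subtype]
    obtain ⟨y, hy, hxy⟩ := hspan (Submodule.mem_map_of_mem hx)
    have : x - y ∈ B := by
      rw [← B.ker_mkQ, LinearMap.mem_ker, map_sub, hxy, sub_self]
    rw [← sub_add_cancel x y]
    refine Submodule.add_mem_sup this ?_
    simpa using hy

/-- Passing to a strictly smaller submodule lowers the relative dimension. -/
lemma of_lt (h : RelDimLE B A (n + 1)) (hBC : B ≤ C) (hCA : C < A) : RelDimLE B C n := by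
  rw [iff_finrank] at h ⊢
  obtain ⟨hfin, hn⟩ := h
  have hlt : C.map B.mkQ < A.map B.mkQ := by
    refine lt_of_le_of_ne (Submodule.map_mono hCA.le) fun heq => hCA.not_ge ?_
    have := congrArg (Submodule.comap B.mkQ) heq
    rw [Submodule.comap_map_mkQ, Submodule.comap_map_mkQ, sup_eq_right.2 hBC] at this
    rw [this]
    exact le_sup_right
  exact ⟨Submodule.finiteDimensional_of_le hlt.le,
    Nat.lt_succ_iff.1 ((Submodule.finrank_lt_finrank_of_lt hlt).trans_le hn)⟩

/-- Adding to `B` a vector of `A` outside `B` lowers the relative dimension of `A`. -/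
lemma sup_span_singleton (h : RelDimLE B A (n + 1)) {s : V} (hsA : s ∈ A) (hsB : s ∉ B) :
    RelDimLE (B ⊔ Submodule.span K {s}) A n := by
  rw [iff_finrank] at h
  obtain ⟨hfin, hn⟩ := h
  rw [iff_finrank]
  -- the quotient by `B + ⟨s⟩` is a further quotient of the one by `B`, with `s` in the kernel
  have hle : B ≤ B ⊔ Submodule.span K {s} := le_sup_left
  let f := Submodule.factor hle
  have hmap : A.map (B ⊔ Submodule.span K {s}).mkQ = (A.map B.mkQ).map f := by
    rw [← Submodule.map_comp]
    rfl
  rw [hmap]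
  refine ⟨inferInstance, ?_⟩
  let g := f.domRestrict (A.map B.mkQ)
  have hg : LinearMap.range g = (A.map B.mkQ).map f := LinearMap.range_domRestrict _ _
  have hker : LinearMap.ker g ≠ ⊥ := by
    intro hbot
    have h0 : (⟨B.mkQ s, Submodule.mem_map_of_mem hsA⟩ : A.map B.mkQ) ∈ LinearMap.ker g := by
      rw [LinearMap.mem_ker]
      change (B ⊔ Submodule.span K {s}).mkQ s = 0
      exact (Submodule.Quotient.mk_eq_zero _).2
        (Submodule.mem_sup_right (Submodule.mem_span_singleton_self s))
    rw [hbot, Submodule.mem_bot, Subtype.ext_iff] at h0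
    exact hsB ((Submodule.Quotient.mk_eq_zero _).1 h0)
  have hrn := LinearMap.finrank_range_add_finrank_ker g
  have hpos : 0 < Module.finrank K (LinearMap.ker g) :=
    Nat.pos_of_ne_zero fun h0 => hker (Submodule.finrank_eq_zero.1 h0)
  rw [hg] at hrn
  omega

lemma quotient_submoduleOf (h : RelDimLE B A n) :
    Module.Finite K (A ⧸ B.submoduleOf A) ∧ Module.finrank K (A ⧸ B.submoduleOf A) ≤ n := by
  rw [iff_finrank] at h
  obtain ⟨hfin, hn⟩ := h
  have hker : LinearMap.ker (B.mkQ.domRestrict A) = B.submoduleOf A := by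
    ext x
    simp [Submodule.submoduleOf]
  have hrange : LinearMap.range (B.mkQ.domRestrict A) = A.map B.mkQ :=
    LinearMap.range_domRestrict _ _
  let e : (A ⧸ B.submoduleOf A) ≃ₗ[K] A.map B.mkQ :=
    (Submodule.quotEquivOfEq _ _ hker.symm).trans
      ((B.mkQ.domRestrict A).quotKerEquivRange.trans (LinearEquiv.ofEq _ _ hrange))
  exact ⟨Module.Finite.equiv e.symm, e.finrank_eq.trans_le hn⟩

end RelDimLE

/-! ### Graded submodules and their brackets -/

namespace LieSuperalgebra

section Homogeneous

variable {K L : Type*} [CommRing K] [AddCommGroup L] [Module K L] [LieSuperalgebra K L]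

/-- A submodule is homogeneous if it is spanned by its even and its odd elements. -/
def Homogeneous (S : Submodule K L) : Prop := S ≤ (S ⊓ part 0) ⊔ (S ⊓ part 1)

lemma Homogeneous.le_of {S T : Submodule K L} (hS : Homogeneous S)
    (h : ∀ i, ∀ x ∈ S, x ∈ part (K := K) i → x ∈ T) : S ≤ T :=
  hS.trans (sup_le (fun x hx => h 0 x hx.1 hx.2) (fun x hx => h 1 x hx.1 hx.2))

lemma Homogeneous.map₂_le {M : Type*} [AddCommGroup M] [Module K M] {f : L →ₗ[K] L →ₗ[K] M}
    {S T : Submodule K L} {U : Submodule K M} (hS : Homogeneous S) (hT : Homogeneous T)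
    (h : ∀ i j, ∀ x ∈ S, x ∈ part (K := K) i → ∀ y ∈ T, y ∈ part (K := K) j → f x y ∈ U) :
    Submodule.map₂ f S T ≤ U := by
  rw [Submodule.map₂_le]
  intro x hx y hy
  have h1 : ∀ j, ∀ y ∈ T, y ∈ part (K := K) j → S ≤ U.comap (f.flip y) := fun j y hy hyj =>
    hS.le_of fun i x hx hxi => h i j x hx hxi y hy hyj
  exact hT.le_of (T := U.comap (f x)) (fun j y hy hyj => h1 j y hy hyj hx) hy

lemma mem_homogeneous_hull {S : Submodule K L} {x : L} {i : ZMod 2} (hx : x ∈ S)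
    (hi : x ∈ part (K := K) i) : x ∈ (S ⊓ part 0) ⊔ (S ⊓ part 1) := by
  have : ∀ i : ZMod 2, i = 0 ∨ i = 1 := by decide
  rcases this i with rfl | rfl
  · exact Submodule.mem_sup_left ⟨hx, hi⟩
  · exact Submodule.mem_sup_right ⟨hx, hi⟩

lemma homogeneous_top : Homogeneous (⊤ : Submodule K L) := by
  rw [Homogeneous, top_inf_eq, top_inf_eq, isCompl_part.sup_eq_top]

lemma Homogeneous.sup {S T : Submodule K L} (hS : Homogeneous S) (hT : Homogeneous T) :
    Homogeneous (S ⊔ T) :=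
  sup_le (hS.le_of fun _ _ hx hi => mem_homogeneous_hull (Submodule.mem_sup_left hx) hi)
    (hT.le_of fun _ _ hx hi => mem_homogeneous_hull (Submodule.mem_sup_right hx) hi)

lemma homogeneous_span_singleton {x : L} {i : ZMod 2} (hx : x ∈ part (K := K) i) :
    Homogeneous (Submodule.span K {x}) := by
  rw [Homogeneous, Submodule.span_singleton_le_iff_mem]
  exact mem_homogeneous_hull (Submodule.mem_span_singleton_self x) hx

lemma Homogeneous.map₂_brk {S T : Submodule K L} (hS : Homogeneous S) (hT : Homogeneous T) :
    Homogeneous (Submodule.map₂ brk S T) :=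
  hS.map₂_le hT fun _ _ _ hx hxi _ hy hyj =>
    mem_homogeneous_hull (Submodule.apply_mem_map₂ _ hx hy) (brk_mem hxi hyj)

lemma map₂_brk_comm_le {S T : Submodule K L} (hS : Homogeneous S) (hT : Homogeneous T) :
    Submodule.map₂ brk S T ≤ Submodule.map₂ brk T S := by
  refine hS.map₂_le hT fun i j x hx hxi y hy hyj => ?_
  rw [skew hxi hyj]
  exact Submodule.neg_mem _ (Submodule.smul_mem _ _ (Submodule.apply_mem_map₂ _ hy hx))

/-- The graded Jacobi identity for homogeneous submodules. -/
lemma map₂_brk_assoc_le {S T U V : Submodule K L} (hS : Homogeneous S) (hT : Homogeneous T)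
    (hU : Homogeneous U) (h1 : Submodule.map₂ brk S (Submodule.map₂ brk T U) ≤ V)
    (h2 : Submodule.map₂ brk T (Submodule.map₂ brk S U) ≤ V) :
    Submodule.map₂ brk (Submodule.map₂ brk S T) U ≤ V := by
  refine (hS.map₂_brk hT).map₂_le hU fun _ k w hw _ z hz hzk => ?_
  have h : Submodule.map₂ brk S T ≤ V.comap ((brk (K := K) (L := L)).flip z) := by
    refine hS.map₂_le hT fun i j x hx hxi y hy hyj => ?_
    change brk (brk x y) z ∈ V
    rw [← sub_eq_iff_eq_add.2 (jacobi hxi hyj hzk)]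
    exact sub_mem
      (h1 (Submodule.apply_mem_map₂ _ hx (Submodule.apply_mem_map₂ _ hy hz)))
      (Submodule.smul_mem _ _
        (h2 (Submodule.apply_mem_map₂ _ hy (Submodule.apply_mem_map₂ _ hx hz))))
  exact h hw

lemma homogeneous_lowerCentral (c : ℕ) : Homogeneous (lowerCentral K L c) := by
  induction c with
  | zero => exact homogeneous_top
  | succ c ih => exact ih.map₂_brk homogeneous_top

lemma homogeneous_derived : Homogeneous (derived K L) :=
  homogeneous_top.map₂_brk homogeneous_top

lemma lowerCentral_succ_le (c : ℕ) : lowerCentral K L (c + 1) ≤ lowerCentral K L c := by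
  induction c with
  | zero => exact le_top
  | succ c ih => exact Submodule.map₂_le_map₂_left ih

lemma antitone_lowerCentral : Antitone (lowerCentral K L) :=
  antitone_nat_of_succ_le lowerCentral_succ_le

lemma map₂_brk_top_lowerCentral_le (c : ℕ) :
    Submodule.map₂ brk ⊤ (lowerCentral K L c) ≤ lowerCentral K L (c + 1) :=
  map₂_brk_comm_le homogeneous_top (homogeneous_lowerCentral c)

/-- A subalgebra of a nilpotent Lie superalgebra that generates it modulo `L²` is everything. -/
lemma eq_top_of_sup_derived_eq_top (hL : Nilpotent K L) {P : Submodule K L}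
    (hP : Submodule.map₂ brk P P ≤ P) (h : P ⊔ derived K L = ⊤) : P = ⊤ := by
  have key : ∀ c, P ⊔ lowerCentral K L c = ⊤ := by
    intro c
    induction c with
    | zero => exact sup_top_eq P
    | succ c ih =>
      rw [eq_top_iff, ← h]
      refine sup_le le_sup_left ?_
      change Submodule.map₂ brk ⊤ ⊤ ≤ _
      calc Submodule.map₂ brk (⊤ : Submodule K L) ⊤
          = Submodule.map₂ brk (P ⊔ lowerCentral K L c) (P ⊔ lowerCentral K L c) := by rw [ih]
        _ ≤ P ⊔ lowerCentral K L (c + 1) := by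
          rw [Submodule.map₂_sup_left, Submodule.map₂_sup_right]
          refine sup_le (sup_le (hP.trans le_sup_left) ?_) ?_
          · exact ((Submodule.map₂_le_map₂_left le_top).trans
              (map₂_brk_top_lowerCentral_le c)).trans le_sup_right
          · exact (Submodule.map₂_le_map₂_right le_top).trans le_sup_right
  obtain ⟨c, hc⟩ := hL
  simpa [hc] using key c

end Homogeneous

section EvenHom

variable {K F L : Type*} [CommRing K] [AddCommGroup F] [Module K F] [LieSuperalgebra K F]
  [AddCommGroup L] [Module K L] [LieSuperalgebra K L] {f : F →ₗ[K] L}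

lemma homogeneous_ker (hf : ∀ i, ∀ x ∈ part (K := K) i, f x ∈ part (K := K) i) :
    Homogeneous (LinearMap.ker f) := by
  intro x hx
  obtain ⟨x0, h0, x1, h1, rfl⟩ := Submodule.mem_sup.1
    ((isCompl_part (K := K) (L := F)).sup_eq_top ▸ Submodule.mem_top : x ∈ _)
  rw [LinearMap.mem_ker, map_add] at hx
  have hz : f x0 = 0 := by
    refine Submodule.disjoint_def.1 (isCompl_part (K := K) (L := L)).disjoint _ (hf 0 _ h0) ?_
    rw [eq_neg_of_add_eq_zero_left hx]
    exact Submodule.neg_mem _ (hf 1 _ h1)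
  have hz1 : f x1 = 0 := by rwa [hz, zero_add] at hx
  exact Submodule.add_mem_sup ⟨hz, h0⟩ ⟨hz1, h1⟩

/-- A surjective even linear map has homogeneous preimages of homogeneous elements. -/
lemma exists_homogeneous_preimage (hf : ∀ i, ∀ x ∈ part (K := K) i, f x ∈ part (K := K) i)
    (hsurj : Function.Surjective f) {i : ZMod 2} {y : L} (hy : y ∈ part (K := K) i) :
    ∃ x ∈ part (K := K) i, f x = y := by
  obtain ⟨x, rfl⟩ := hsurj y
  obtain ⟨x0, h0, x1, h1, rfl⟩ := Submodule.mem_sup.1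
    ((isCompl_part (K := K) (L := F)).sup_eq_top ▸ Submodule.mem_top : x ∈ _)
  rw [map_add] at hy ⊢
  have hd := Submodule.disjoint_def.1 (isCompl_part (K := K) (L := L)).disjoint
  have : ∀ i : ZMod 2, i = 0 ∨ i = 1 := by decide
  rcases this i with rfl | rfl
  · refine ⟨x0, h0, ?_⟩
    rw [hd (f x1) (by simpa using sub_mem hy (hf 0 _ h0)) (hf 1 _ h1), add_zero]
  · refine ⟨x1, h1, ?_⟩
    rw [hd (f x0) (hf 0 _ h0) (by simpa using sub_mem hy (hf 1 _ h1)), zero_add]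

lemma map_map₂_brk (hb : ∀ x y, f (brk (K := K) x y) = brk (K := K) (f x) (f y))
    (S T : Submodule K F) :
    (Submodule.map₂ brk S T).map f = Submodule.map₂ brk (S.map f) (T.map f) := by
  rw [Submodule.map_map₂, Submodule.map₂_map_map]
  congr 1
  exact LinearMap.ext₂ hb

lemma map_lowerCentral_le (hb : ∀ x y, f (brk (K := K) x y) = brk (K := K) (f x) (f y)) (c : ℕ) :
    (lowerCentral K F c).map f ≤ lowerCentral K L c := by
  induction c with
  | zero => exact le_top
  | succ c ih =>
    change (Submodule.map₂ brk (lowerCentral K F c) ⊤).map f ≤ _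
    rw [map_map₂_brk hb]
    exact Submodule.map₂_le_map₂ ih le_top

lemma map_derived (hb : ∀ x y, f (brk (K := K) x y) = brk (K := K) (f x) (f y))
    (hsurj : Function.Surjective f) : (derived K F).map f = derived K L := by
  rw [derived, map_map₂_brk hb, Submodule.map_top, LinearMap.range_eq_top.2 hsurj]
  rfl

end EvenHom

/-! ### The upper bound -/

section UpperBound

variable {K F : Type*} [Field K] [AddCommGroup F] [Module K F] [LieSuperalgebra K F]

lemma brk_mem_comm {i j : ZMod 2} {x y : F} {V : Submodule K F}
    (hx : x ∈ part (K := K) i) (hy : y ∈ part (K := K) j) (h : brk (K := K) x y ∈ V) :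
    brk (K := K) y x ∈ V := by
  rw [skew hy hx]
  exact Submodule.neg_mem _ (Submodule.smul_mem _ _ h)

/-- If `F` is spanned by homogeneous `a`, `b` modulo `T`, then `[F, F]` is spanned modulo `[F, T]`
by the brackets of `a` and `b`. -/
lemma derived_le_of_top_le {p q : ZMod 2} {a b : F} (ha : a ∈ part (K := K) p)
    (hb : b ∈ part (K := K) q) {T : Submodule K F} (hT : Homogeneous T)
    (htop : ⊤ ≤ Submodule.span K {a, b} ⊔ T) :
    derived K F ≤ Submodule.map₂ brk ⊤ T ⊔
      Submodule.span K {brk (K := K) b b, brk (K := K) b a, brk (K := K) a a} := by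
  have hU : Submodule.map₂ brk (⊤ : Submodule K F) ⊤ ≤
      Submodule.map₂ brk (Submodule.span K {a, b} ⊔ T) (Submodule.span K {a, b} ⊔ T) :=
    Submodule.map₂_le_map₂ htop htop
  refine hU.trans ?_
  rw [Submodule.map₂_sup_right, Submodule.map₂_sup_left]
  refine sup_le (sup_le ?_ ?_) ?_
  · refine le_sup_of_le_right ?_
    rw [Submodule.map₂_span_span, Submodule.span_le]
    have hbb : brk (K := K) b b ∈ Submodule.span K
        {brk (K := K) b b, brk (K := K) b a, brk (K := K) a a} :=
      Submodule.subset_span (by simp)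
    have hba : brk (K := K) b a ∈ Submodule.span K
        {brk (K := K) b b, brk (K := K) b a, brk (K := K) a a} :=
      Submodule.subset_span (by simp)
    have haa : brk (K := K) a a ∈ Submodule.span K
        {brk (K := K) b b, brk (K := K) b a, brk (K := K) a a} :=
      Submodule.subset_span (by simp)
    rintro _ ⟨x, hx, y, hy, rfl⟩
    rcases hx with rfl | rfl <;> rcases hy with rfl | rfl
    · exact haa
    · exact brk_mem_comm hb ha hba
    · exact hba
    · exact hbb
  · exact le_sup_of_le_left ((Submodule.map₂_le_map₂_right le_top).trans
      (map₂_brk_comm_le hT homogeneous_top))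
  · exact le_sup_of_le_left (Submodule.map₂_le_map₂_left le_top)

/-- If `F` is generated by `a`, `b` modulo the ideal `S`, and `[F, s] ≤ S`, then `[F, S + ⟨s⟩]` is
spanned modulo `[F, S]` by `[a, s]` and `[b, s]`: by the Jacobi identity `[[F, F], s] ≤ [F, S]`. -/
lemma map₂_brk_sup_span_singleton_le {a b : F} {S : Submodule K F} (hS : Homogeneous S)
    (htop : ⊤ ≤ Submodule.span K {a, b} ⊔ derived K F ⊔ S) {k : ZMod 2} {s : F}
    (hs : s ∈ part (K := K) k)
    (hsS : Submodule.map₂ brk ⊤ (Submodule.span K {s}) ≤ S) :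
    Submodule.map₂ brk ⊤ (S ⊔ Submodule.span K {s}) ≤
      Submodule.map₂ brk ⊤ S ⊔ Submodule.span K {brk (K := K) a s, brk (K := K) b s} := by
  have hs' := homogeneous_span_singleton hs
  rw [Submodule.map₂_sup_right]
  refine sup_le le_sup_left ?_
  refine (Submodule.map₂_le_map₂_left htop).trans ?_
  rw [Submodule.map₂_sup_left, Submodule.map₂_sup_left]
  refine sup_le (sup_le ?_ ?_) ?_
  · refine le_sup_of_le_right ?_
    rw [Submodule.map₂_span_span, Submodule.span_le]
    rintro _ ⟨x, hx, y, hy, rfl⟩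
    obtain rfl := Set.mem_singleton_iff.1 hy
    rcases hx with rfl | rfl
    · exact Submodule.subset_span (by simp)
    · exact Submodule.subset_span (by simp)
  · exact le_sup_of_le_left (map₂_brk_assoc_le homogeneous_top homogeneous_top hs'
      (Submodule.map₂_le_map₂_right hsS) (Submodule.map₂_le_map₂_right hsS))
  · refine le_sup_of_le_left ((map₂_brk_comm_le hS hs').trans ?_)
    exact Submodule.map₂_le_map₂_left le_top

/-- For odd `b` the Jacobi identity reads `2 [b, [b, x]] = [[b, b], x]`. -/
lemma two_smul_brk_brk_self {b x : F} {j : ZMod 2} (hb : b ∈ part (K := K) 1)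
    (hx : x ∈ part (K := K) j) :
    (2 : K) • brk (K := K) b (brk (K := K) b x) = brk (K := K) (brk (K := K) b b) x := by
  have h := jacobi (K := K) hb hb hx
  have hsign : parSign K 1 1 = -1 := by
    simp [parSign, ZMod.val_one]
  rw [hsign, neg_one_smul, ← sub_eq_add_neg, eq_sub_iff_add_eq] at h
  rw [two_smul, h]

/-- If `[F, F]` is spanned modulo `S` by the single vector `s`, with `[F, F] ≰ S`, then `[a, s]`
and `[b, s]` are linearly dependent modulo `[F, S]`. The dependence is the image of the Jacobi
identity for `b`, `b`, `a` (or, if it is trivial there, for `a`, `a`, `b`). -/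
lemma exists_brk_dependence (h2 : (2 : K) ≠ 0) {p : ZMod 2} {a b : F}
    (ha : a ∈ part (K := K) p) (hb : b ∈ part (K := K) 1) {S : Submodule K F} (hS : Homogeneous S)
    (htop : ⊤ ≤ Submodule.span K {a, b} ⊔ derived K F ⊔ S) {s : F}
    (hder : derived K F ≤ S ⊔ Submodule.span K {s}) (hnot : ¬ derived K F ≤ S)
    (hS3 : Submodule.map₂ brk ⊤ (derived K F) ≤ S) (hSi : Submodule.map₂ brk ⊤ S ≤ S) :
    ∃ w, Submodule.span K {brk (K := K) a s, brk (K := K) b s} ≤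
      Submodule.map₂ brk ⊤ S ⊔ Submodule.span K {w} := by
  set V := Submodule.map₂ brk ⊤ S with hV
  have hq : ∀ x y : F, ∃ c : K, brk (K := K) x y - c • s ∈ S := by
    intro x y
    obtain ⟨u, hu, v, hv, huv⟩ := Submodule.mem_sup.1
      (hder (Submodule.apply_mem_map₂ brk (Submodule.mem_top : x ∈ ⊤) (Submodule.mem_top : y ∈ ⊤)))
    obtain ⟨c, rfl⟩ := Submodule.mem_span_singleton.1 hv
    exact ⟨c, by rwa [← huv, add_sub_cancel_right]⟩
  have hred : ∀ {x y : F} {c : K} (z : F), brk (K := K) x y - c • s ∈ S →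
      brk (K := K) z (brk (K := K) x y) - c • brk (K := K) z s ∈ V := by
    intro x y c z h
    rw [← map_smul, ← map_sub]
    exact Submodule.apply_mem_map₂ _ Submodule.mem_top h
  -- the Jacobi identity for `x`, `x`, `y` with `x` odd
  have hjac : ∀ {x y : F} {j : ZMod 2} {β γ : K}, x ∈ part (K := K) 1 → y ∈ part (K := K) j →
      brk (K := K) x x - β • s ∈ S → brk (K := K) x y - γ • s ∈ S →
      β • brk (K := K) y s + (2 * γ) • brk (K := K) x s ∈ V := by
    intro x y j β γ hx hy hxx hxy
    have h1 := hred y hxx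
    have h2 := Submodule.smul_mem _ (2 : K) (hred x hxy)
    have hxx0 : brk (K := K) x x ∈ part (K := K) 0 := brk_mem hx hx
    rw [smul_sub, two_smul_brk_brk_self hx hy, skew hxx0 hy] at h2
    have hsign : parSign K 0 j = 1 := by simp [parSign]
    rw [hsign, one_smul] at h2
    have h3 := neg_mem (add_mem h1 h2)
    convert h3 using 1
    rw [mul_smul]
    abel
  obtain ⟨β, hβ⟩ := hq b b
  obtain ⟨γ, hγ⟩ := hq b a
  obtain ⟨α, hα⟩ := hq a a
  have hrel := hjac hb ha hβ hγ
  have hmem : ∀ {x y : F} {c d : K}, c ≠ 0 → c • x + d • y ∈ V → x ∈ V ⊔ Submodule.span K {y} := by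
    intro x y c d hc h
    have hx : x = c⁻¹ • (c • x + d • y) + (-(c⁻¹ * d)) • y := by
      rw [smul_add, smul_smul, inv_mul_cancel₀ hc, one_smul, neg_smul, mul_smul]
      abel
    rw [hx]
    exact Submodule.add_mem_sup (Submodule.smul_mem _ _ h)
      (Submodule.smul_mem _ _ (Submodule.mem_span_singleton_self y))
  by_cases hβ0 : β = 0
  · refine ⟨brk (K := K) a s, ?_⟩
    rw [Submodule.span_le, Set.insert_subset_iff, Set.singleton_subset_iff]
    refine ⟨Submodule.mem_sup_right (Submodule.mem_span_singleton_self _), ?_⟩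
    by_cases hγ0 : γ = 0
    · -- then `[a, a] ∉ S`, so `a` is odd and the Jacobi identity for `a`, `a`, `b` applies
      subst hβ0 hγ0
      rw [zero_smul, sub_zero] at hβ hγ
      have hα0 : α ≠ 0 := by
        rintro rfl
        rw [zero_smul, sub_zero] at hα
        refine hnot ?_
        refine (derived_le_of_top_le ha hb (homogeneous_derived.sup hS)
          (by rwa [← sup_assoc])).trans (sup_le ?_ ?_)
        · rw [Submodule.map₂_sup_right]
          exact sup_le hS3 hSi
        · rw [Submodule.span_le]
          rintro _ (rfl | rfl | rfl)
          exacts [hβ, hγ, hα]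
      have hp : p = 1 := by
        have : ∀ i : ZMod 2, i = 0 ∨ i = 1 := by decide
        rcases this p with rfl | rfl
        · exfalso
          rw [even_self ha, zero_sub] at hα
          have hsS : s ∈ S := by
            have := Submodule.smul_mem _ α⁻¹ (neg_mem hα)
            rwa [neg_neg, smul_smul, inv_mul_cancel₀ hα0, one_smul] at this
          exact hnot (hder.trans (sup_le le_rfl
            ((Submodule.span_singleton_le_iff_mem _ _).2 hsS)))
        · rfl
      subst hp
      have hab : brk (K := K) a b - (0 : K) • s ∈ S := by
        rw [zero_smul, sub_zero]
        exact brk_mem_comm hb ha hγ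
      exact hmem hα0 (hjac ha hb hα hab)
    · rw [add_comm] at hrel
      exact hmem (mul_ne_zero h2 hγ0) hrel
  · refine ⟨brk (K := K) b s, ?_⟩
    rw [Submodule.span_le, Set.insert_subset_iff, Set.singleton_subset_iff]
    exact ⟨hmem hβ0 hrel, Submodule.mem_sup_right (Submodule.mem_span_singleton_self _)⟩

lemma relDimLE_derived {p : ZMod 2} {a b : F} (ha : a ∈ part (K := K) p)
    (hb : b ∈ part (K := K) 1) {S : Submodule K F} (hS : Homogeneous S)
    (htop : ⊤ ≤ Submodule.span K {a, b} ⊔ S) :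
    RelDimLE (Submodule.map₂ brk ⊤ S) (derived K F) (2 + p.val) := by
  classical
  have h := derived_le_of_top_le ha hb hS htop
  have : ∀ i : ZMod 2, i = 0 ∨ i = 1 := by decide
  rcases this p with rfl | rfl
  · refine .of_le_span {brk (K := K) b b, brk (K := K) b a} (h.trans (sup_le_sup_left ?_ _))
      Finset.card_le_two
    rw [even_self ha, Submodule.span_le]
    rintro _ (rfl | rfl | rfl)
    · exact Submodule.subset_span (by simp)
    · exact Submodule.subset_span (by simp)
    · exact zero_mem _
  · refine .of_le_span {brk (K := K) b b, brk (K := K) b a, brk (K := K) a a}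
      (h.trans (sup_le_sup_left ?_ _)) Finset.card_le_three
    simp

/-- Let `S` be a homogeneous ideal of `F` with nilpotent quotient such that `F` is generated modulo
`S` by `a` of parity `p` and the odd element `b`, and suppose that `(F / S)²` has dimension at most
`j`. Then `(S ∩ F²) / [F, S]` has dimension at most `max j 1 + 1 + p`. -/
theorem relDimLE_inf_derived (h2 : (2 : K) ≠ 0) {p : ZMod 2} {a b : F}
    (ha : a ∈ part (K := K) p) (hb : b ∈ part (K := K) 1) (j : ℕ) :
    ∀ S : Submodule K F, Homogeneous S → Submodule.map₂ brk ⊤ S ≤ S →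
      (∃ c, lowerCentral K F c ≤ S) → ⊤ ≤ Submodule.span K {a, b} ⊔ derived K F ⊔ S →
      RelDimLE S (derived K F) j →
      RelDimLE (Submodule.map₂ brk ⊤ S) (S ⊓ derived K F) (max j 1 + 1 + p.val) := by
  classical
  -- the case in which `S` contains `[F, F]`
  have base : ∀ j, ∀ S : Submodule K F, Homogeneous S →
      ⊤ ≤ Submodule.span K {a, b} ⊔ derived K F ⊔ S → derived K F ≤ S →
      RelDimLE (Submodule.map₂ brk ⊤ S) (S ⊓ derived K F) (max j 1 + 1 + p.val) := by
    intro j S hS htop hle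
    rw [inf_eq_right.2 hle]
    refine (relDimLE_derived ha hb hS ?_).mono (by omega)
    rwa [sup_assoc, sup_eq_right.2 hle] at htop
  induction j with
  | zero =>
    rintro S hS - - htop ⟨t, ht, hle⟩
    refine base 0 S hS htop ?_
    rw [Finset.card_eq_zero.1 (Nat.le_zero.1 ht)] at hle
    simpa using hle
  | succ j ih =>
    intro S hS hSi hc htop hj
    by_cases hle : derived K F ≤ S
    · exact base _ S hS htop hle
    -- a homogeneous `s ∈ [F, F]` outside `S` that is central modulo `S`, from the last term of the
    -- descending central sequence that does not lie in `S`
    obtain ⟨k, hk1, hkn, hkS⟩ : ∃ k, 1 ≤ k ∧ ¬ lowerCentral K F k ≤ S ∧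
        lowerCentral K F (k + 1) ≤ S := by
      have hspec := Nat.find_spec hc
      have hmin := fun m => Nat.find_min hc (m := m)
      generalize Nat.find hc = c at hspec hmin
      have hc2 : 2 ≤ c := by
        by_contra hlt
        exact hle ((antitone_lowerCentral (by omega : c ≤ 1)).trans hspec)
      obtain ⟨k, rfl⟩ : ∃ k, c = k + 1 := ⟨c - 1, by omega⟩
      exact ⟨k, by omega, hmin k (by omega), hspec⟩
    obtain ⟨i, s, hsk, hsi, hsS⟩ : ∃ i, ∃ s ∈ lowerCentral K F k, s ∈ part (K := K) i ∧ s ∉ S := by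
      by_contra! hcon
      exact hkn ((homogeneous_lowerCentral k).le_of fun i x hx hi => hcon i x hx hi)
    have hsder : s ∈ derived K F := antitone_lowerCentral hk1 hsk
    have hFs : Submodule.map₂ brk ⊤ (Submodule.span K {s}) ≤ S :=
      ((Submodule.map₂_le_map₂_right ((Submodule.span_singleton_le_iff_mem _ _).2 hsk)).trans
        (map₂_brk_top_lowerCentral_le k)).trans hkS
    set S' := S ⊔ Submodule.span K {s} with hS'
    have hsS' : s ∈ S' := Submodule.mem_sup_right (Submodule.mem_span_singleton_self s)
    have hS'h : Homogeneous S' := hS.sup (homogeneous_span_singleton hsi)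
    have hFS' : Submodule.map₂ brk ⊤ S' ≤ S := by
      rw [hS', Submodule.map₂_sup_right]
      exact sup_le hSi hFs
    have hj' : RelDimLE S' (derived K F) j := hj.sup_span_singleton hsder hsS
    have hIH := ih S' hS'h (hFS'.trans le_sup_left) (hc.imp fun c h => h.trans le_sup_left)
      (htop.trans (sup_le_sup_left le_sup_left _)) hj'
    have hspan := map₂_brk_sup_span_singleton_le hS htop hsi hFs
    have hlt : S ⊓ derived K F < S' ⊓ derived K F := by
      refine lt_of_le_of_ne (inf_le_inf_right _ le_sup_left) fun heq => hsS ?_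
      exact (heq.ge (⟨hsS', hsder⟩ : s ∈ S' ⊓ derived K F)).1
    have hbot : Submodule.map₂ brk ⊤ S ≤ S ⊓ derived K F :=
      le_inf hSi (Submodule.map₂_le_map₂_right le_top)
    rcases Nat.eq_zero_or_pos j with rfl | hjpos
    · have hder : derived K F ≤ S ⊔ Submodule.span K {s} := by
        obtain ⟨t, ht, hle'⟩ := hj'
        rw [Finset.card_eq_zero.1 (Nat.le_zero.1 ht)] at hle'
        simpa using hle'
      obtain ⟨w, hw⟩ := exists_brk_dependence h2 ha hb hS htop hder hle
        ((Submodule.map₂_le_map₂_right hder).trans hFS') hSi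
      have hone : RelDimLE (Submodule.map₂ brk ⊤ S) (Submodule.map₂ brk ⊤ S') 1 :=
        .of_le_span {w} (hspan.trans (sup_le le_sup_left (by simpa using hw))) (by simp)
      exact ((hone.trans hIH).mono (by simp; omega)).of_lt hbot hlt
    · have htwo : RelDimLE (Submodule.map₂ brk ⊤ S) (Submodule.map₂ brk ⊤ S') 2 :=
        .of_le_span {brk (K := K) a s, brk (K := K) b s} (by simpa using hspan)
          Finset.card_le_two
      exact ((htwo.trans hIH).mono (by omega)).of_lt hbot hlt

end UpperBound

end LieSuperalgebra

/-! ### A residually nilpotent Lie superalgebra of infinite dimension -/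

section Shift

open Polynomial

/-- The underlying space of the semidirect product of the Lie superalgebra with basis `y`, `y²`
(`y` odd, `[y, y] = 2y²`) and the abelian Lie superalgebra `K[X] ⊕ K[X]`, whose first summand is
even and whose second is odd. The action is `[y, (u, w)] = (X w, X u)`, and `y²` acts as `X²`.
The element `(α, β, u, w)` stands for `α y + β y² + (u, w)`. -/
abbrev ShiftSuperalgebra (K : Type*) [CommRing K] := K × K × K[X] × K[X]

namespace ShiftSuperalgebra

variable {K : Type*} [CommRing K]

lemma ext {x y : ShiftSuperalgebra K} (h1 : x.1 = y.1) (h2 : x.2.1 = y.2.1)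
    (h3 : x.2.2.1 = y.2.2.1) (h4 : x.2.2.2 = y.2.2.2) : x = y :=
  Prod.ext h1 (Prod.ext h2 (Prod.ext h3 h4))

/-- The bracket of the shift superalgebra. -/
noncomputable def bracket :
    ShiftSuperalgebra K →ₗ[K] ShiftSuperalgebra K →ₗ[K] ShiftSuperalgebra K :=
  LinearMap.mk₂ K (fun x y => (0, 2 * x.1 * y.1,
      C x.1 * X * y.2.2.2 + C x.2.1 * X ^ 2 * y.2.2.1
        + C y.1 * X * x.2.2.2 - C y.2.1 * X ^ 2 * x.2.2.1,
      C x.1 * X * y.2.2.1 + C x.2.1 * X ^ 2 * y.2.2.2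
        - C y.1 * X * x.2.2.1 - C y.2.1 * X ^ 2 * x.2.2.2))
    (by intros; apply ext <;> simp <;> ring)
    (by intros; apply ext <;> simp [smul_eq_C_mul] <;> ring)
    (by intros; apply ext <;> simp <;> ring)
    (by intros; apply ext <;> simp [smul_eq_C_mul] <;> ring)

lemma bracket_apply (x y : ShiftSuperalgebra K) : bracket x y = (0, 2 * x.1 * y.1,
    C x.1 * X * y.2.2.2 + C x.2.1 * X ^ 2 * y.2.2.1
      + C y.1 * X * x.2.2.2 - C y.2.1 * X ^ 2 * x.2.2.1,
    C x.1 * X * y.2.2.1 + C x.2.1 * X ^ 2 * y.2.2.2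
      - C y.1 * X * x.2.2.1 - C y.2.1 * X ^ 2 * x.2.2.2) := rfl

/-- The even part (`i = 0`) and the odd part (`i = 1`) of the shift superalgebra. -/
def parityPart (i : ZMod 2) : Submodule K (ShiftSuperalgebra K) where
  carrier := {x | (i = 0 → x.1 = 0 ∧ x.2.2.2 = 0) ∧ (i = 1 → x.2.1 = 0 ∧ x.2.2.1 = 0)}
  zero_mem' := by simp
  add_mem' := by
    rintro x y ⟨hx0, hx1⟩ ⟨hy0, hy1⟩
    exact ⟨fun h => by simp [hx0 h, hy0 h], fun h => by simp [hx1 h, hy1 h]⟩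
  smul_mem' := by
    rintro c x ⟨hx0, hx1⟩
    exact ⟨fun h => by simp [hx0 h], fun h => by simp [hx1 h]⟩

lemma mem_parityPart_zero {x : ShiftSuperalgebra K} :
    x ∈ parityPart 0 ↔ x.1 = 0 ∧ x.2.2.2 = 0 := by
  change (_ ∧ _) ↔ _
  simp

lemma mem_parityPart_one {x : ShiftSuperalgebra K} :
    x ∈ parityPart 1 ↔ x.2.1 = 0 ∧ x.2.2.1 = 0 := by
  change (_ ∧ _) ↔ _
  simp

lemma bracket_mem {i j : ZMod 2} {x y : ShiftSuperalgebra K} (hx : x ∈ parityPart i)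
    (hy : y ∈ parityPart j) : bracket x y ∈ parityPart (i + j) := by
  have h2 : ∀ i : ZMod 2, i = 0 ∨ i = 1 := by decide
  have h11 : (1 : ZMod 2) + 1 = 0 := by decide
  rcases h2 i with rfl | rfl <;> rcases h2 j with rfl | rfl <;>
    simp only [add_zero, zero_add, h11, mem_parityPart_zero, mem_parityPart_one] at hx hy ⊢ <;>
    simp [bracket_apply, hx.1, hx.2, hy.1, hy.2]

lemma bracket_skew {i j : ZMod 2} {x y : ShiftSuperalgebra K} (hx : x ∈ parityPart i)
    (hy : y ∈ parityPart j) : bracket x y = -(parSign K i j • bracket y x) := by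
  have h2 : ∀ i : ZMod 2, i = 0 ∨ i = 1 := by decide
  rcases h2 i with rfl | rfl <;> rcases h2 j with rfl | rfl <;>
    simp only [mem_parityPart_zero, mem_parityPart_one] at hx hy <;>
    simp only [parSign, bracket_apply, ZMod.val_zero, ZMod.val_one, mul_zero, zero_mul, mul_one,
      pow_zero, pow_one, one_smul, neg_smul, neg_neg, hx.1, hx.2, hy.1, hy.2] <;>
    apply ext <;> simp <;> ring

lemma bracket_jacobi {i j k : ZMod 2} {x y z : ShiftSuperalgebra K} (hx : x ∈ parityPart i)
    (hy : y ∈ parityPart j) (hz : z ∈ parityPart k) :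
    bracket x (bracket y z) = bracket (bracket x y) z + parSign K i j • bracket y (bracket x z) := by
  have h2 : ∀ i : ZMod 2, i = 0 ∨ i = 1 := by decide
  have hC : (C 2 : K[X]) = 2 := rfl
  rcases h2 i with rfl | rfl <;> rcases h2 j with rfl | rfl <;> rcases h2 k with rfl | rfl <;>
    simp only [mem_parityPart_zero, mem_parityPart_one] at hx hy hz <;>
    simp only [parSign, bracket_apply, ZMod.val_zero, ZMod.val_one, mul_zero, zero_mul, mul_one,
      pow_zero, pow_one, one_smul, neg_smul, hx.1, hx.2, hy.1, hy.2, hz.1, hz.2] <;>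
    apply ext <;> simp [hC] <;> ring

noncomputable instance : LieSuperalgebra K (ShiftSuperalgebra K) where
  part := parityPart
  isCompl_part := by
    constructor
    · rw [Submodule.disjoint_def]
      intro x h0 h1
      rw [mem_parityPart_zero] at h0
      rw [mem_parityPart_one] at h1
      exact ext h0.1 h1.1 h1.2 h0.2
    · rw [codisjoint_iff, eq_top_iff]
      rintro ⟨α, β, u, w⟩ -
      have h : ((α, β, u, w) : ShiftSuperalgebra K) = (0, β, u, 0) + (α, 0, 0, w) := by simp
      rw [h]
      exact Submodule.add_mem_sup (mem_parityPart_zero.2 ⟨rfl, rfl⟩)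
        (mem_parityPart_one.2 ⟨rfl, rfl⟩)
  brk := bracket
  brk_mem := bracket_mem
  skew := bracket_skew
  jacobi := bracket_jacobi
  even_self := by
    intro x hx
    rw [mem_parityPart_zero] at hx
    simp only [bracket_apply, hx.1, hx.2]
    apply ext <;> simp

lemma brk_apply (x y : ShiftSuperalgebra K) :
    LieSuperalgebra.brk (K := K) x y = (0, 2 * x.1 * y.1,
      C x.1 * X * y.2.2.2 + C x.2.1 * X ^ 2 * y.2.2.1
        + C y.1 * X * x.2.2.2 - C y.2.1 * X ^ 2 * x.2.2.1,
      C x.1 * X * y.2.2.1 + C x.2.1 * X ^ 2 * y.2.2.2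
        - C y.1 * X * x.2.2.1 - C y.2.1 * X ^ 2 * x.2.2.2) := rfl

/-- The shift superalgebra is residually nilpotent. -/
lemma eq_bot_of_le_map₂_brk {T : Submodule K (ShiftSuperalgebra K)}
    (hT : T ≤ Submodule.map₂ LieSuperalgebra.brk ⊤ T) : T = ⊥ := by
  -- to find an element of `T` in `U`, it suffices to find there the brackets with elements of `T`
  have step : ∀ U : Submodule K (ShiftSuperalgebra K),
      (∀ x, ∀ t ∈ T, LieSuperalgebra.brk (K := K) x t ∈ U) → T ≤ U := fun U hU =>
    hT.trans (Submodule.map₂_le.2 fun x _ t ht => hU x t ht)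
  have h1 : ∀ t ∈ T, t.1 = 0 := fun t ht =>
    step (LinearMap.ker (LinearMap.fst K K _)) (fun _ _ _ => rfl) ht
  have h2 : ∀ t ∈ T, t.2.1 = 0 := fun t ht =>
    step (LinearMap.ker (LinearMap.fst K K _ ∘ₗ LinearMap.snd K K _)) (fun x t ht => by
      change (2 * x.1 * t.1 : K) = 0
      rw [h1 t ht, mul_zero]) ht
  have h3 : ∀ n : ℕ, ∀ t ∈ T, X ^ n ∣ t.2.2.1 ∧ X ^ n ∣ t.2.2.2 := by
    intro n
    induction n with
    | zero => simp
    | succ n ih =>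
      intro t ht
      let U : Submodule K (ShiftSuperalgebra K) :=
        { carrier := {t | X ^ (n + 1) ∣ t.2.2.1 ∧ X ^ (n + 1) ∣ t.2.2.2}
          zero_mem' := by simp
          add_mem' := fun ha hb => ⟨dvd_add ha.1 hb.1, dvd_add ha.2 hb.2⟩
          smul_mem' := fun c x hx => ⟨dvd_smul_of_dvd c hx.1, dvd_smul_of_dvd c hx.2⟩ }
      refine step U (fun x t ht => ?_) ht
      obtain ⟨⟨u, hu⟩, ⟨w, hw⟩⟩ := ih t ht
      change X ^ (n + 1) ∣ _ ∧ X ^ (n + 1) ∣ _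
      rw [brk_apply, h1 t ht, h2 t ht, hu, hw]
      exact ⟨⟨C x.1 * w + C x.2.1 * X * u, by simp; ring⟩,
        ⟨C x.1 * u + C x.2.1 * X * w, by simp; ring⟩⟩
  have h4 : ∀ f : K[X], (∀ n : ℕ, X ^ n ∣ f) → f = 0 := fun f hf => by
    ext n
    exact X_pow_dvd_iff.1 (hf (n + 1)) n (Nat.lt_succ_self n)
  rw [eq_bot_iff]
  intro t ht
  exact ext (h1 t ht) (h2 t ht) (h4 _ fun n => (h3 n t ht).1) (h4 _ fun n => (h3 n t ht).2)

/-- The generator `y`. -/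
noncomputable def y : ShiftSuperalgebra K := (1, 0, 0, 0)

/-- The element `1` of the summand `K[X]` of parity `p`. -/
noncomputable def v (p : ZMod 2) : ShiftSuperalgebra K :=
  if p = 0 then (0, 0, 1, 0) else (0, 0, 0, 1)

lemma y_mem : (y : ShiftSuperalgebra K) ∈ LieSuperalgebra.part (K := K) 1 :=
  mem_parityPart_one.2 ⟨rfl, rfl⟩

lemma v_mem (p : ZMod 2) : (v p : ShiftSuperalgebra K) ∈ LieSuperalgebra.part (K := K) p := by
  have : ∀ i : ZMod 2, i = 0 ∨ i = 1 := by decide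
  rcases this p with rfl | rfl
  · exact mem_parityPart_zero.2 ⟨rfl, rfl⟩
  · exact mem_parityPart_one.2 ⟨rfl, rfl⟩

/-- The linear map `(α, β, u, w) ↦ u + w`. -/
noncomputable def total : ShiftSuperalgebra K →ₗ[K] K[X] :=
  (LinearMap.fst K _ _ + LinearMap.snd K _ _) ∘ₗ LinearMap.snd K _ _ ∘ₗ LinearMap.snd K _ _

/-- The elements `y` and `v p` generate a subalgebra that is not finite dimensional. -/
lemma map_total_eq_top {P : Submodule K (ShiftSuperalgebra K)} {p : ZMod 2} (hy : y ∈ P)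
    (hv : v p ∈ P) (hP : ∀ a ∈ P, ∀ b ∈ P, LieSuperalgebra.brk (K := K) a b ∈ P) :
    P.map total = ⊤ := by
  have key : ∀ n : ℕ, ∃ u w : K[X], ((0, 0, u, w) : ShiftSuperalgebra K) ∈ P ∧ u + w = X ^ n := by
    intro n
    induction n with
    | zero =>
      unfold v at hv
      split_ifs at hv
      · exact ⟨1, 0, hv, by simp⟩
      · exact ⟨0, 1, hv, by simp⟩
    | succ n ih =>
      obtain ⟨u, w, h, huw⟩ := ih
      refine ⟨X * w, X * u, ?_, by rw [pow_succ, ← huw]; ring⟩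
      have := hP _ hy _ h
      rw [brk_apply] at this
      simpa [y] using this
  rw [eq_top_iff]
  intro f _
  rw [← f.sum_monomial_eq, sum_def]
  refine Submodule.sum_mem _ fun n _ => ?_
  obtain ⟨u, w, h, huw⟩ := key n
  rw [← C_mul_X_pow_eq_monomial, ← smul_eq_C_mul]
  exact Submodule.smul_mem _ _ ⟨_, h, huw⟩

end ShiftSuperalgebra

end Shift

/-! ### Homomorphisms from a free Lie superalgebra -/

namespace FreeLieSuper

open LieSuperalgebra

variable {K X : Type*} [CommRing K] {p : X → ZMod 2}

lemma of_mem (x : X) : of K p x ∈ part (K := K) (p x) :=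
  Submodule.mem_map_of_mem (Finsupp.single_mem_supported K _ rfl)

lemma mkQ_single_mul (u w : FreeMagma X) :
    (relIdeal K p).mkQ (Finsupp.single (FreeMagma.mul u w) 1) =
      brk (K := K) ((relIdeal K p).mkQ (Finsupp.single u 1))
        ((relIdeal K p).mkQ (Finsupp.single w 1)) := by
  change _ = freeBrk p _ _
  rw [freeBrk_mk, wordMul_single, mul_one]

lemma hom_ext {M : Type*} [AddCommGroup M] [Module K M] [LieSuperalgebra K M]
    {f g : FreeLieSuperalgebra K p →ₗ[K] M}
    (hf : ∀ x y, f (brk (K := K) x y) = brk (K := K) (f x) (f y))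
    (hg : ∀ x y, g (brk (K := K) x y) = brk (K := K) (g x) (g y))
    (h : ∀ x, f (of K p x) = g (of K p x)) : f = g := by
  refine Submodule.linearMap_qext _ (Finsupp.lhom_ext' fun w => LinearMap.ext_ring ?_)
  change f ((relIdeal K p).mkQ (Finsupp.single w 1)) = g ((relIdeal K p).mkQ (Finsupp.single w 1))
  induction w with
  | ih1 x => exact h x
  | ih2 u w hu hw =>
    have := mkQ_single_mul (K := K) (p := p) u w
    change f ((relIdeal K p).mkQ (Finsupp.single (FreeMagma.mul u w) 1)) =
      g ((relIdeal K p).mkQ (Finsupp.single (FreeMagma.mul u w) 1))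
    rw [this, hf, hg, hu, hw]

/-- Free Lie superalgebras are projective: an even homomorphism from a free Lie superalgebra to `L`
lifts along every surjective even homomorphism to `L`. -/
lemma exists_lift_along {F L : Type*} [AddCommGroup F] [Module K F] [LieSuperalgebra K F]
    [AddCommGroup L] [Module K L] [LieSuperalgebra K L] {π : F →ₗ[K] L}
    (hπ : ∀ x y, π (brk (K := K) x y) = brk (K := K) (π x) (π y))
    (hπm : ∀ i, ∀ x ∈ part (K := K) i, π x ∈ part (K := K) i) (hsurj : Function.Surjective π)
    {f : FreeLieSuperalgebra K p →ₗ[K] L}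
    (hf : ∀ x y, f (brk (K := K) x y) = brk (K := K) (f x) (f y))
    (hfm : ∀ i, ∀ x : FreeLieSuperalgebra K p, x ∈ part (K := K) i → f x ∈ part (K := K) i) :
    ∃ ψ : FreeLieSuperalgebra K p →ₗ[K] F,
      (∀ x y : FreeLieSuperalgebra K p, ψ (brk (K := K) x y) = brk (K := K) (ψ x) (ψ y)) ∧ ∀ x, π (ψ x) = f x := by
  have hex : ∀ x, ∃ z ∈ part (K := K) (p x), π z = f (of K p x) := fun x =>
    exists_homogeneous_preimage hπm hsurj (hfm _ _ (of_mem x))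
  choose s hs hπs using hex
  have hψ := lift_brk (K := K) s hs
  refine ⟨lift s hs, hψ, fun x => ?_⟩
  have heq : π ∘ₗ lift s hs = f := by
    refine hom_ext (fun x y => ?_) hf fun x => ?_
    · rw [LinearMap.comp_apply, hψ, hπ]
      rfl
    · rw [LinearMap.comp_apply, lift_of, hπs]
  exact LinearMap.congr_fun heq x

lemma span_range_of_sup_derived :
    Submodule.span K (Set.range (of K p)) ⊔ derived K (FreeLieSuperalgebra K p) = ⊤ := by
  rw [eq_top_iff]
  intro x _
  obtain ⟨a, rfl⟩ := (relIdeal K p).mkQ_surjective x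
  induction a using Finsupp.induction_linear with
  | zero => simp
  | add a b ha hb => rw [map_add]; exact add_mem (ha trivial) (hb trivial)
  | single w c =>
    rw [← mul_one c, ← smul_eq_mul, ← Finsupp.smul_single, map_smul]
    refine Submodule.smul_mem _ _ ?_
    cases w with
    | of x => exact Submodule.mem_sup_left (Submodule.subset_span ⟨x, rfl⟩)
    | mul u w =>
      rw [mkQ_single_mul]
      exact Submodule.mem_sup_right (Submodule.apply_mem_map₂ _ trivial trivial)

end FreeLieSuper

/-! ### The multiplier is not zero -/

namespace LieSuperalgebra

open FreeLieSuper

section Comparison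

variable {K F F' L : Type*} [CommRing K] [AddCommGroup F] [Module K F] [LieSuperalgebra K F]
  [AddCommGroup F'] [Module K F'] [LieSuperalgebra K F'] [AddCommGroup L] [Module K L]

/-- If `π : F → L` and `π' : F' → L` factor through each other and `(R ∩ [F, F]) / [F, R]` vanishes
for the kernel `R` of `π`, then the corresponding quotient vanishes for `π'`. -/
lemma ker_inf_derived_le_of_lifts {π : F →ₗ[K] L} {π' : F' →ₗ[K] L} {ι : F' →ₗ[K] F}
    {ψ : F →ₗ[K] F'} (hι : ∀ x y, ι (brk (K := K) x y) = brk (K := K) (ι x) (ι y))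
    (hψ : ∀ x y, ψ (brk (K := K) x y) = brk (K := K) (ψ x) (ψ y))
    (hπι : ∀ x, π (ι x) = π' x) (hπψ : ∀ x, π' (ψ x) = π x)
    (hR' : Homogeneous (LinearMap.ker π'))
    (hle : LinearMap.ker π ⊓ derived K F ≤ Submodule.map₂ brk ⊤ (LinearMap.ker π)) :
    LinearMap.ker π' ⊓ derived K F' ≤ Submodule.map₂ brk ⊤ (LinearMap.ker π') := by
  -- the endomorphism `ψ ι` is the identity modulo `R'`, hence modulo `[F', R']` on `[F', F']`
  have hsub : ∀ x, ψ (ι x) - x ∈ LinearMap.ker π' := by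
    intro x
    rw [LinearMap.mem_ker, map_sub, sub_eq_zero, hπψ, hπι]
  have hsub2 : derived K F' ≤
      (Submodule.map₂ brk ⊤ (LinearMap.ker π')).comap (ψ ∘ₗ ι - LinearMap.id : F' →ₗ[K] F') := by
    refine Submodule.map₂_le.2 fun x _ y _ => ?_
    have heq : (ψ ∘ₗ ι - LinearMap.id : F' →ₗ[K] F') (brk (K := K) x y) =
        brk (K := K) (ψ (ι x) - x) (ψ (ι y)) + brk (K := K) x (ψ (ι y) - y) := by
      simp only [LinearMap.sub_apply, LinearMap.comp_apply, LinearMap.id_apply, hι, hψ, map_sub]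
      abel
    rw [Submodule.mem_comap, heq]
    exact add_mem (map₂_brk_comm_le hR' homogeneous_top
      (Submodule.apply_mem_map₂ _ (hsub x) trivial)) (Submodule.apply_mem_map₂ _ trivial (hsub y))
  rintro x ⟨hx, hxd⟩
  have hιx : ι x ∈ LinearMap.ker π ⊓ derived K F :=
    ⟨(hπι x).trans hx, map_lowerCentral_le hι 1 (Submodule.mem_map_of_mem hxd)⟩
  have hψx : ψ (ι x) ∈ Submodule.map₂ brk ⊤ (LinearMap.ker π') := by
    have hmem := Submodule.mem_map_of_mem (f := ψ) (hle hιx)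
    rw [map_map₂_brk hψ] at hmem
    refine Submodule.map₂_le_map₂ le_top ?_ hmem
    rw [Submodule.map_le_iff_le_comap]
    exact fun z hz => (hπψ z).trans hz
  have h := sub_mem hψx (hsub2 hxd)
  rwa [LinearMap.sub_apply, LinearMap.comp_apply, LinearMap.id_apply, sub_sub_cancel] at h

end Comparison

variable {K L : Type*} [Field K] [AddCommGroup L] [Module K L]

/-- The kernel `R` of a linear map from the free Lie superalgebra `F` on an odd and a further
generator to a finite dimensional space is not contained in `[F, R]`: otherwise `R` would be killed
by all homomorphisms to the residually nilpotent shift superalgebra, while one of them has an image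
of infinite dimension. -/
lemma not_ker_le_map₂_brk_of_bool [FiniteDimensional K L] {q : Bool → ZMod 2}
    (hq : q false = 1) {f : FreeLieSuperalgebra K q →ₗ[K] L} :
    ¬ LinearMap.ker f ≤ Submodule.map₂ brk ⊤ (LinearMap.ker f) := by
  intro hle
  let g : Bool → ShiftSuperalgebra K := fun t =>
    cond t (ShiftSuperalgebra.v (q true)) ShiftSuperalgebra.y
  have hg : ∀ t, g t ∈ part (K := K) (q t) := by
    rintro (_ | _)
    · rw [hq]; exact ShiftSuperalgebra.y_mem
    · exact ShiftSuperalgebra.v_mem _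
  let φ := lift g hg
  have hφ : ∀ x y, φ (brk (K := K) x y) = brk (K := K) (φ x) (φ y) := lift_brk g hg
  have hbot : (LinearMap.ker f).map φ = ⊥ := by
    refine ShiftSuperalgebra.eq_bot_of_le_map₂_brk ((Submodule.map_mono hle).trans ?_)
    rw [map_map₂_brk hφ]
    exact Submodule.map₂_le_map₂_left le_top
  have htop : (LinearMap.range φ).map ShiftSuperalgebra.total = ⊤ := by
    refine ShiftSuperalgebra.map_total_eq_top (p := q true) ⟨of K q false, lift_of g hg false⟩
      ⟨of K q true, lift_of g hg true⟩ ?_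
    rintro _ ⟨x, rfl⟩ _ ⟨y, rfl⟩
    exact ⟨_, hφ x y⟩
  have hker : LinearMap.ker f ≤ LinearMap.ker (ShiftSuperalgebra.total ∘ₗ φ) := by
    intro x hx
    have : φ x ∈ (LinearMap.ker f).map φ := Submodule.mem_map_of_mem hx
    rw [hbot, Submodule.mem_bot] at this
    simp [this]
  have hfin : Module.Finite K (FreeLieSuperalgebra K q ⧸ LinearMap.ker f) :=
    Module.Finite.equiv f.quotKerEquivRange.symm
  refine Polynomial.not_finite (R := K)
    (Module.Finite.of_surjective ((LinearMap.ker f).liftQ _ hker) ?_)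
  rw [← LinearMap.range_eq_top, Submodule.range_liftQ, LinearMap.range_comp, htop]

variable [LieSuperalgebra K L]

lemma range_brk_closed {F : Type*} [AddCommGroup F] [Module K F] [LieSuperalgebra K F]
    {f : F →ₗ[K] L} (hf : ∀ x y, f (brk (K := K) x y) = brk (K := K) (f x) (f y)) :
    Submodule.map₂ brk (LinearMap.range f) (LinearMap.range f) ≤ LinearMap.range f := by
  rw [Submodule.map₂_le]
  rintro _ ⟨x, rfl⟩ _ ⟨y, rfl⟩
  exact ⟨_, hf x y⟩

lemma presentation_brk (x y) : presentation K L (brk (K := K) x y) =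
    brk (K := K) (presentation K L x) (presentation K L y) :=
  lift_brk _ _ _ _

lemma presentation_mem (i : ZMod 2) (x) (hx : x ∈ part (K := K) i) :
    presentation K L x ∈ part (K := K) i :=
  lift_mem _ _ hx

/-- The multiplier of a nilpotent `L` with two homogeneous generators, one of them odd, that are
linearly independent modulo `L²` is not zero. If it were, then `(R ∩ [F, F]) / [F, R]` would also
vanish for the free presentation on these two generators, for which `R ≤ [F, F]`. -/
theorem not_ker_inf_derived_le [FiniteDimensional K L] (hL : Nilpotent K L) {p : ZMod 2} {a b : L}
    (ha : a ∈ part (K := K) p) (hb : b ∈ part (K := K) 1)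
    (htop : Submodule.span K {a, b} ⊔ derived K L = ⊤)
    (hind : ∀ α β : K, α • a + β • b ∈ derived K L → α = 0 ∧ β = 0) :
    ¬ LinearMap.ker (presentation K L) ⊓ derived K _ ≤
      Submodule.map₂ brk ⊤ (LinearMap.ker (presentation K L)) := by
  intro hle
  let q : Bool → ZMod 2 := fun t => cond t p 1
  let g : Bool → L := fun t => cond t a b
  have hg : ∀ t, g t ∈ part (K := K) (q t) := by
    rintro (_ | _)
    exacts [hb, ha]
  let π' : FreeLieSuperalgebra K q →ₗ[K] L := lift g hg
  have hπ' : ∀ x y, π' (brk (K := K) x y) = brk (K := K) (π' x) (π' y) := lift_brk g hg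
  have hπ'a : π' (of K q true) = a := lift_of g hg true
  have hπ'b : π' (of K q false) = b := lift_of g hg false
  have hπ'm : ∀ i, ∀ x ∈ part (K := K) i, π' x ∈ part (K := K) i := fun i x hx => lift_mem g hg hx
  have hsurj : Function.Surjective π' := by
    rw [← LinearMap.range_eq_top]
    refine eq_top_of_sup_derived_eq_top hL (range_brk_closed hπ') (eq_top_iff.2 ?_)
    rw [← htop]
    refine sup_le_sup_right ?_ _
    rw [Submodule.span_le]
    rintro _ (rfl | rfl)
    exacts [⟨_, hπ'a⟩, ⟨_, hπ'b⟩]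
  obtain ⟨ι, hι, hπι⟩ := exists_lift_along (presentation_brk (K := K) (L := L)) presentation_mem
    (presentation_surjective K L) hπ' hπ'm
  obtain ⟨ψ, hψ, hπψ⟩ := exists_lift_along hπ' hπ'm hsurj
    (presentation_brk (K := K) (L := L)) presentation_mem
  have hder : LinearMap.ker π' ≤ derived K _ := by
    intro x hx
    obtain ⟨u, hu, d, hd, rfl⟩ := Submodule.mem_sup.1
      (span_range_of_sup_derived (K := K) (p := q) ▸ Submodule.mem_top : x ∈ _)
    rw [Bool.range_eq, Submodule.mem_span_pair] at hu
    obtain ⟨β, α, rfl⟩ := hu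
    rw [LinearMap.mem_ker, map_add, map_add, map_smul, map_smul, hπ'a, hπ'b] at hx
    have hπd : π' d ∈ derived K L := map_derived hπ' hsurj ▸ Submodule.mem_map_of_mem hd
    have h0 := hind α β (by
      rw [add_comm, eq_neg_of_add_eq_zero_left hx]
      exact neg_mem hπd)
    rw [h0.1, h0.2, zero_smul, zero_smul, zero_add, zero_add]
    exact hd
  refine not_ker_le_map₂_brk_of_bool (K := K) (q := q) rfl (f := π') ?_
  have := ker_inf_derived_le_of_lifts hι hψ hπι hπψ (homogeneous_ker hπ'm) hle
  rwa [inf_eq_left.2 hder] at this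

end LieSuperalgebra

/-! ### Generators of `L`, and the bounds -/

namespace RelDimLE

variable {K V W : Type*} [Field K] [AddCommGroup V] [Module K V] [AddCommGroup W] [Module K W]

lemma ker_of_finrank_map_le {f : V →ₗ[K] W} {A : Submodule K V} {n : ℕ}
    [FiniteDimensional K (A.map f)] (h : Module.finrank K (A.map f) ≤ n) :
    RelDimLE (LinearMap.ker f) A n := by
  let g := (LinearMap.ker f).liftQ f le_rfl
  have hg : Function.Injective g := LinearMap.ker_eq_bot.1 (Submodule.ker_liftQ_eq_bot' _ _ rfl)
  have hmap : (A.map (LinearMap.ker f).mkQ).map g = A.map f := by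
    rw [← Submodule.map_comp, Submodule.liftQ_mkQ]
  let e : A.map (LinearMap.ker f).mkQ ≃ₗ[K] A.map f :=
    (Submodule.equivMapOfInjective g hg _).trans (LinearEquiv.ofEq _ _ hmap)
  rw [iff_finrank]
  exact ⟨Module.Finite.equiv e.symm, e.finrank_eq.trans_le h⟩

end RelDimLE

namespace LieSuperalgebra

variable {K L : Type*} [Field K] [AddCommGroup L] [Module K L] [LieSuperalgebra K L]

/-- A nilpotent Lie superalgebra whose odd part lies in `L²` has no odd part: it is generated by
its even part. -/
lemma part_one_eq_bot_of_le_derived (hL : Nilpotent K L) (h : part 1 ≤ derived K L) :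
    part (K := K) (L := L) 1 = ⊥ := by
  have htop : part (K := K) (L := L) 0 = ⊤ := by
    refine eq_top_of_sup_derived_eq_top hL
      (Submodule.map₂_le.2 fun x hx y hy => by simpa using brk_mem hx hy) (eq_top_iff.2 ?_)
    rw [← isCompl_part.sup_eq_top]
    exact sup_le_sup_left h _
  have := (isCompl_part (K := K) (L := L)).inf_eq_bot
  rwa [htop, top_inf_eq] at this

/-- A nilpotent `L` with `dim L² = dim L - 2` and nonzero odd part has two homogeneous generators,
one of them odd, which form a basis modulo `L²`. -/
lemma exists_homogeneous_generators [FiniteDimensional K L] (hL : Nilpotent K L)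
    (h1 : part (K := K) (L := L) 1 ≠ ⊥)
    (hd : Module.finrank K (derived K L) + 2 = Module.finrank K L) :
    ∃ (p : ZMod 2) (a b : L), a ∈ part (K := K) p ∧ b ∈ part (K := K) 1 ∧
      Submodule.span K {a, b} ⊔ derived K L = ⊤ ∧
      ∀ α β : K, α • a + β • b ∈ derived K L → α = 0 ∧ β = 0 := by
  obtain ⟨b, hb, hbd⟩ : ∃ b ∈ part (K := K) (L := L) 1, b ∉ derived K L := by
    by_contra! hcon
    exact h1 (part_one_eq_bot_of_le_derived hL hcon)
  set D := derived K L
  set E := D ⊔ Submodule.span K {b} with hE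
  obtain ⟨p, a, ha, haE⟩ : ∃ p, ∃ a ∈ part (K := K) (L := L) p, a ∉ E := by
    by_contra! hcon
    have htop : E = ⊤ := eq_top_iff.2 (homogeneous_top.le_of fun i x _ hx => hcon i x hx)
    have hle : Module.finrank K E ≤
        Module.finrank K D + Module.finrank K (Submodule.span K {b}) :=
      Submodule.finrank_add_le_finrank_add_finrank _ _
    have hone : Module.finrank K (Submodule.span K {b}) ≤ 1 :=
      (finrank_span_le_card ({b} : Set L)).trans (by simp)
    rw [htop, finrank_top] at hle
    omega
  refine ⟨p, a, b, ha, hb, ?_, fun α β h => ?_⟩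
  · have hlt1 : D < E := lt_of_le_of_ne le_sup_left fun h => hbd
      (h.ge (Submodule.mem_sup_right (Submodule.mem_span_singleton_self b)))
    have hlt2 : E < E ⊔ Submodule.span K {a} := lt_of_le_of_ne le_sup_left fun h => haE
      (h.ge (Submodule.mem_sup_right (Submodule.mem_span_singleton_self a)))
    have h3 := Submodule.finrank_lt_finrank_of_lt hlt1
    have h4 := Submodule.finrank_lt_finrank_of_lt hlt2
    have h5 := Submodule.finrank_le (E ⊔ Submodule.span K {a})
    have htop := Submodule.eq_top_of_finrank_eq (S := E ⊔ Submodule.span K {a}) (by omega)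
    rw [← htop, hE, Submodule.span_insert]
    ac_rfl
  · have hα : α = 0 := by
      by_contra hα
      refine haE ?_
      have : a = α⁻¹ • (α • a + β • b) + (-(α⁻¹ * β)) • b := by
        rw [smul_add, smul_smul, inv_mul_cancel₀ hα, one_smul, neg_smul, mul_smul]
        abel
      rw [this]
      exact Submodule.add_mem_sup (Submodule.smul_mem _ _ h)
        (Submodule.smul_mem _ _ (Submodule.mem_span_singleton_self b))
    refine ⟨hα, ?_⟩
    by_contra hβ
    rw [hα, zero_smul, zero_add] at h
    exact hbd ((Submodule.smul_mem_iff _ hβ).1 h)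

/-- The upper bound for the multiplier of a nilpotent Lie superalgebra with two generators, of
which one is odd and the other one has parity `p`. -/
theorem relDimLE_schurMultiplier [FiniteDimensional K L] (h2 : (2 : K) ≠ 0) (hL : Nilpotent K L)
    {p : ZMod 2} {a b : L} (ha : a ∈ part (K := K) p) (hb : b ∈ part (K := K) 1)
    (htop : Submodule.span K {a, b} ⊔ derived K L = ⊤) :
    RelDimLE (Submodule.map₂ brk ⊤ (LinearMap.ker (presentation K L)))
      (LinearMap.ker (presentation K L) ⊓ derived K _)
      (max (Module.finrank K (derived K L)) 1 + 1 + p.val) := by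
  have hsurj := presentation_surjective K L
  have hder := map_derived (presentation_brk (K := K) (L := L)) hsurj
  let x : Σ i : ZMod 2, part (K := K) (L := L) i := ⟨p, a, ha⟩
  let y : Σ i : ZMod 2, part (K := K) (L := L) i := ⟨1, b, hb⟩
  have hx : presentation K L (FreeLieSuper.of K _ x) = a := FreeLieSuper.lift_of _ _ _
  have hy : presentation K L (FreeLieSuper.of K _ y) = b := FreeLieSuper.lift_of _ _ _
  refine relDimLE_inf_derived h2 (FreeLieSuper.of_mem x) (FreeLieSuper.of_mem y) _ _
    (homogeneous_ker presentation_mem) ?_ ?_ ?_ ?_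
  · refine Submodule.map₂_le.2 fun u _ r hr => ?_
    rw [LinearMap.mem_ker] at hr ⊢
    rw [presentation_brk, hr, map_zero]
  · obtain ⟨c, hc⟩ := hL
    refine ⟨c, fun u hu => ?_⟩
    have := map_lowerCentral_le (presentation_brk (K := K) (L := L)) c
      (Submodule.mem_map_of_mem hu)
    rwa [hc] at this
  · rw [← Submodule.comap_map_eq, Submodule.map_sup, hder, Submodule.map_span, Set.image_pair,
      hx, hy, htop, Submodule.comap_top]
  · have : FiniteDimensional K ((derived K _).map (presentation K L)) := inferInstance
    exact .ker_of_finrank_map_le (by rw [hder])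

end LieSuperalgebra

theorem theoremt1p15 (K L : Type*) [Field K] (h2 : (2 : K) ≠ 0)
    [AddCommGroup L] [Module K L] [LieSuperalgebra K L] [FiniteDimensional K L]
    (hL : LieSuperalgebra.Nilpotent K L) (m n : ℕ)
    (hm : Module.finrank K (LieSuperalgebra.part (K := K) (L := L) 0) = m)
    (hn : Module.finrank K (LieSuperalgebra.part (K := K) (L := L) 1) = n)
    (hdim : 2 < m + n) (hn1 : 1 ≤ n)
    (hL2 : Module.finrank K (LieSuperalgebra.derived K L) = m + n - 2) :
    Module.Finite K (LieSuperalgebra.SchurMultiplier K L) ∧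
      (∃ k : ℕ, LieSuperalgebra.t K L = k) ∧
      ((n : ℚ) + m) * (n + m - 3) + 4 ≤ 2 * LieSuperalgebra.t K L ∧
      2 * LieSuperalgebra.t K L < ((n : ℚ) + m) ^ 2 + n - m := by
  have hmn : Module.finrank K L = m + n := by
    rw [← hm, ← hn]
    exact (Submodule.finrank_add_eq_of_isCompl LieSuperalgebra.isCompl_part).symm
  obtain ⟨p, a, b, ha, hb, htop, hind⟩ := LieSuperalgebra.exists_homogeneous_generators hL
    (fun h => by rw [h, finrank_bot] at hn; omega) (by omega)
  have hp : 1 + p.val ≤ n := by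
    have : ∀ i : ZMod 2, i = 0 ∨ i = 1 := by decide
    rcases this p with rfl | rfl
    · simpa using hn1
    · -- two odd generators are linearly independent in the odd part
      have hli : LinearIndependent K ![a, b] := LinearIndependent.pair_iff.2 fun α β h =>
        hind α β (by rw [h]; exact zero_mem _)
      have hle : Submodule.span K (Set.range ![a, b]) ≤ LieSuperalgebra.part (K := K) 1 := by
        rw [Submodule.span_le]
        rintro _ ⟨i, rfl⟩
        fin_cases i
        exacts [ha, hb]
      have hcard := Submodule.finrank_mono hle
      rw [finrank_span_eq_card hli, hn, Fintype.card_fin] at hcard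
      simpa [ZMod.val_one] using hcard
  obtain ⟨hfin, hD⟩ :=
    (LieSuperalgebra.relDimLE_schurMultiplier h2 hL ha hb htop).quotient_submoduleOf
  change Module.Finite K (LieSuperalgebra.SchurMultiplier K L) at hfin
  change Module.finrank K (LieSuperalgebra.SchurMultiplier K L) ≤ _ at hD
  have hpos : 0 < Module.finrank K (LieSuperalgebra.SchurMultiplier K L) := by
    refine Nat.pos_of_ne_zero fun h0 => ?_
    have hsub := Module.finrank_zero_iff.1 h0
    rw [Submodule.Quotient.subsingleton_iff, Submodule.submoduleOf_eq_top] at hsub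
    exact LieSuperalgebra.not_ker_inf_derived_le hL ha hb htop hind hsub
  have ht : LieSuperalgebra.t K L = 1 / 2 * (((n : ℚ) + m) ^ 2 + (n - m)) -
      Module.finrank K (LieSuperalgebra.SchurMultiplier K L) := by
    rw [LieSuperalgebra.t, hm, hn]
  rw [ht]
  generalize Module.finrank K (LieSuperalgebra.SchurMultiplier K L) = D at hD hpos
  have hD' : D + 2 ≤ 2 * n + m := by
    rw [hL2, max_eq_left (by omega)] at hD
    omega
  have hDq : (D : ℚ) + 2 ≤ 2 * n + m := by exact_mod_cast hD'
  have hposq : (1 : ℚ) ≤ D := by exact_mod_cast hpos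
  refine ⟨hfin, ?_, by nlinarith, by linarith⟩
  obtain ⟨e, he⟩ := Nat.even_mul_succ_self (n + m)
  have hle : m + D ≤ e := by nlinarith
  refine ⟨e - (m + D), ?_⟩
  have heq : ((n : ℚ) + m) * (n + m + 1) = e + e := by exact_mod_cast he
  rw [Nat.cast_sub hle]
  push_cast
  linarith
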